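/- Consider functions $\phi:\mathbb R\to\mathbb R$ with derivatives understood in the weak sense, and put \[ L(\phi)=\int_{\mathbb R}\frac{(\phi')^2}{2}-\phi\,dx,\qquad \mathcal E(\phi)=\int_{\mathbb R}|\phi''|^2\,dx, \] \[ M=\{\phi\in C_c^\infty(\mathbb R): \phi\ge 0,\ L(\phi)=1\},\qquad \overline M=\{\phi\in W^{2,2}(\mathbb R)\cap L^1(\mathbb R): \phi\ge 0,\ L(\phi)=1\}. \] Let $\rho$ be the smallest positive solution of $\tan\rho=\rho$, let $r=6^{1/3}\approx 1.82$ and $\mu=\rho/r\approx 2.47$, and put \[ \alpha=-\frac{r}{\mu\sin(\mu r)}\approx 0.75,\qquad a=\frac{r^2}{2}+\frac r\mu\cot(\mu r)\approx 1.81 . \] Then the function \[ \bar u(x)=\begin{cases} a-\frac{x^2}{2}+\alpha\cos(\mu x), & |x|<r,\\ 0, & |x|\ge r,\end{cases} \] belongs to $\overline M$ and minimises $\mathcal E$ over $\overline M$. It has the following properties. (i) $1<\mathcal E(\bar u)<\infty$; more precisely \[ \mathcal E(\bar u)=\min_{\overline M}\mathcal E=\inf_{M}\mathcal E=\Theta,\qquad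 \Theta=6^{1/3}\rho^2\approx 36.69 . \] (ii) $\bar u\in C^{2,1}(\mathbb R)\setminus C^3(\mathbb R)$, i.e. $\bar u$ is $C^2$ with Lipschitz continuous second derivative, but not $C^3$. (iii) $\bar u$ has compact support, and $\{\bar u>0\}$ is non-empty and connected. (iv) $\bar u$ is even. (v) $\bar u$ is nondecreasing on $(-\infty,0]$ and nonincreasing on $[0,\infty)$, and it is strictly increasing on $[-r,0]$ and strictly decreasing on $[0,r]$. Here $\approx$ means that the error is less than $0.005$. -/

import Mathlib

open MeasureTheory Set
open scoped ContDiff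

noncomputable section

/-- `g` is a weak (distributional) derivative of `f` on the real line. -/
def HasWeakDeriv (f g : ℝ → ℝ) : Prop :=
  LocallyIntegrable f ∧ LocallyIntegrable g ∧
    ∀ ψ : ℝ → ℝ, ContDiff ℝ ∞ ψ → HasCompactSupport ψ →
      ∫ x, f x * deriv ψ x = -∫ x, g x * ψ x

open Classical in
/-- A representative of the weak derivative of `f` (unique up to null sets), if there is one. -/
def weakDeriv (f : ℝ → ℝ) : ℝ → ℝ :=
  if h : ∃ g, HasWeakDeriv f g then h.choose else 0

/-- Membership in the Sobolev space `W^{2,2}(ℝ)`. -/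
def MemW22 (f : ℝ → ℝ) : Prop :=
  MemLp f 2 ∧ ∃ g h : ℝ → ℝ,
    HasWeakDeriv f g ∧ HasWeakDeriv g h ∧ MemLp g 2 ∧ MemLp h 2

/-- The functional `L(φ) = ∫ ((φ')²/2 - φ)`. -/
def excessLength (φ : ℝ → ℝ) : ℝ :=
  ∫ x, ((weakDeriv φ x) ^ 2 / 2 - φ x)

/-- The energy `∫ |φ''|²`. -/
def bendingEnergy (φ : ℝ → ℝ) : ℝ :=
  ∫ x, (weakDeriv (weakDeriv φ) x) ^ 2

/-- The class `M` of smooth, compactly supported admissible functions. -/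
def smoothClass : Set (ℝ → ℝ) :=
  {φ | ContDiff ℝ ∞ φ ∧ HasCompactSupport φ ∧ (∀ x, 0 ≤ φ x) ∧ excessLength φ = 1}

/-- The larger class of admissible functions in `W^{2,2}(ℝ) ∩ L¹(ℝ)`. -/
def sobolevClass : Set (ℝ → ℝ) :=
  {φ | MemW22 φ ∧ Integrable φ ∧ (∀ᵐ x, 0 ≤ φ x) ∧ excessLength φ = 1}

end

/-!
Why the theorem holds. Write `A = ∫ φ'²`, `E = ∫ φ''²` and `B = ∫ φ`. The constraint says
`A = 2 + 2B`, and the lower bound on `E` is equivalent, by dilation and the inequality of arithmetic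
and geometric means (`le_bendingEnergy`), to the sharp interpolation inequality
`A ≤ E + 3 / (2ρ³) B²` for nonnegative functions (`integral_deriv_sq_le`). By mollification and
cut-off (`exists_smooth_approx`) it is enough to prove it for smooth functions of compact support,
and the same approximation, followed by a dilation, identifies the infimum over the smooth class.

For smooth `φ ≥ 0` the inequality is split at a maximum point `x₀`, with `m = φ x₀`. On either side
one has `∫ φ''² - φ'² + 2cmφ ≥ (c²ρ³/3) m²` (`half_line_energy_ge`), where `c m` is the factor that
gives the extremal profile `c m (ρ²/2 + 1 - x²/2 + w cos x)` the height `m`; adding both sides and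
completing the square eliminates `m`. The half-line bound combines two facts.

* On `[x₀, x₀ + ρ]` the energy is a quadratic functional whose second variation is nonnegative for
  fixed boundary data, because `ρ ≤ 2π` and Wirtinger's inequality holds for functions of mean zero
  that vanish at the ends (`initial_energy_ge`). This gives a bound in terms of the value `p` and
  the slope `s` at `x₀ + ρ`; it has no `s²` term since `tan ρ = ρ`.
* Beyond `x₀ + ρ` the energy density is bounded below by an exact derivative,
  `-d/dx ((3/5) φφ' - (4/9) φ'³/φ)`, whenever `0 ≤ φ ≤ m` (`calibrated_energy_ge`).

If `s ≤ 0` the two bounds match (`matching_inequality`). If `s > 0`, the function has a minimum in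
`[x₀, x₀ + ρ]`, up to which `descent_energy_ge` applies, and a later maximum, from which on one
argues by induction on the length of the support (`half_line_energy_ge_aux`).

The value of the energy at the minimiser, which is the extremal profile dilated so that its positive
part is `(-r, r)`, is computed explicitly. It is written as a smooth function composed with the
nearest point projection onto `[-r, r]`, from which its regularity can be read off.
-/

/-! ### The equation `tan ρ = ρ` -/

lemma hasDerivAt_sin_sub_mul_cos (x : ℝ) :
    HasDerivAt (fun y => Real.sin y - y * Real.cos y) (x * Real.sin x) x := by
  have h := (Real.hasDerivAt_sin x).sub ((hasDerivAt_id x).mul (Real.hasDerivAt_cos x))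
  refine h.congr_deriv ?_
  simp

lemma sin_sub_mul_cos_strictMonoOn :
    StrictMonoOn (fun y => Real.sin y - y * Real.cos y) (Icc 0 Real.pi) := by
  refine strictMonoOn_of_deriv_pos (convex_Icc _ _) (by fun_prop) fun x hx => ?_
  rw [interior_Icc] at hx
  rw [(hasDerivAt_sin_sub_mul_cos x).deriv]
  exact mul_pos hx.1 (Real.sin_pos_of_pos_of_lt_pi hx.1 hx.2)

lemma sin_sub_mul_cos_strictAntiOn :
    StrictAntiOn (fun y => Real.sin y - y * Real.cos y) (Icc Real.pi (2 * Real.pi)) := by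
  refine strictAntiOn_of_deriv_neg (convex_Icc _ _) (by fun_prop) fun x hx => ?_
  rw [interior_Icc] at hx
  rw [(hasDerivAt_sin_sub_mul_cos x).deriv]
  have h : Real.sin x < 0 := by
    have := Real.sin_pos_of_pos_of_lt_pi (x := x - Real.pi) (by linarith [hx.1])
      (by linarith [hx.2])
    rw [Real.sin_sub_pi] at this
    linarith
  exact mul_neg_of_pos_of_neg (by linarith [hx.1, Real.pi_pos]) h

/-- The values near `3π/2` are expressed through the small angle `h = 3π/4 - x/2`, for which the
Taylor bounds of Mathlib are sharp enough. -/
lemma sin_sub_mul_cos_eq_half_angle (x : ℝ) :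
    Real.sin x - x * Real.cos x
      = 2 * Real.sin (3 * Real.pi / 4 - x / 2) ^ 2 - 1
        + 2 * x * (Real.sin (3 * Real.pi / 4 - x / 2) * Real.cos (3 * Real.pi / 4 - x / 2)) := by
  set h := 3 * Real.pi / 4 - x / 2 with hh
  have hx : x = Real.pi + (Real.pi / 2 - 2 * h) := by rw [hh]; ring
  have h1 : Real.sin x = -Real.cos (2 * h) := by
    conv_lhs => rw [hx]
    rw [add_comm, Real.sin_add_pi, Real.sin_pi_div_two_sub]
  have h2 : Real.cos x = -Real.sin (2 * h) := by
    conv_lhs => rw [hx]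
    rw [add_comm, Real.cos_add_pi, Real.cos_pi_div_two_sub]
  rw [h1, h2, Real.cos_two_mul, Real.sin_two_mul]
  linear_combination (-2) * Real.sin_sq_add_cos_sq h

lemma small_angle_bounds {h l u : ℝ} (hl : 0 ≤ l) (h1 : l ≤ h) (h2 : h ≤ u) (hu : u ≤ 1) :
    l - u ^ 3 / 6 - u ^ 5 / 100 ≤ Real.sin h ∧
    Real.sin h ≤ u - l ^ 3 / 6 + u ^ 5 / 100 ∧
    1 - u ^ 2 / 2 - u ^ 4 * (5 / 96) ≤ Real.cos h ∧
    Real.cos h ≤ 1 - l ^ 2 / 2 + u ^ 4 * (5 / 96) := by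
  have h0 : 0 ≤ h := hl.trans h1
  have habs : |h| ≤ 1 := by rw [abs_of_nonneg h0]; linarith
  have hs := abs_le.1 (Real.sin_bound habs)
  have hc := abs_le.1 (Real.cos_bound habs)
  rw [abs_of_nonneg h0] at hs hc
  have e2l : l ^ 2 ≤ h ^ 2 := by gcongr
  have e2u : h ^ 2 ≤ u ^ 2 := by gcongr
  have e3l : l ^ 3 ≤ h ^ 3 := by gcongr
  have e3u : h ^ 3 ≤ u ^ 3 := by gcongr
  have e4u : h ^ 4 ≤ u ^ 4 := by gcongr
  have e5u : h ^ 5 ≤ u ^ 5 := by gcongr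
  refine ⟨?_, ?_, ?_, ?_⟩ <;> linarith [hs.1, hs.2, hc.1, hc.2]

lemma sin_sub_mul_cos_pos_of_lower : 0 < Real.sin 4.4933 - 4.4933 * Real.cos 4.4933 := by
  rw [sin_sub_mul_cos_eq_half_angle]
  have p1 := Real.pi_gt_d6
  have p2 := Real.pi_lt_d6
  obtain ⟨a1, -, a3, -⟩ := small_angle_bounds (h := 3 * Real.pi / 4 - 4.4933 / 2)
    (l := 0.109544) (u := 0.109545) (by norm_num) (by norm_num at *; linarith)
    (by norm_num at *; linarith) (by norm_num)
  norm_num at a1 a3 ⊢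
  set s := Real.sin (3 * Real.pi / 4 - 44933 / 20000)
  set c := Real.cos (3 * Real.pi / 4 - 44933 / 20000)
  have b1 : (0.109317 : ℝ) ≤ s := by norm_num; linarith
  have b2 : (0.993992 : ℝ) ≤ c := by norm_num; linarith
  have b3 : (0.109317 : ℝ) * 0.993992 ≤ s * c := by gcongr
  have b4 : (0.109317 : ℝ) ^ 2 ≤ s ^ 2 := by gcongr
  norm_num at b3 b4
  linarith

lemma sin_sub_mul_cos_neg_of_upper : Real.sin 4.4935 - 4.4935 * Real.cos 4.4935 < 0 := by
  rw [sin_sub_mul_cos_eq_half_angle]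
  have p1 := Real.pi_gt_d6
  have p2 := Real.pi_lt_d6
  obtain ⟨a0, a1, a2, a3⟩ := small_angle_bounds (h := 3 * Real.pi / 4 - 4.4935 / 2)
    (l := 0.109444) (u := 0.109445) (by norm_num) (by norm_num at *; linarith)
    (by norm_num at *; linarith) (by norm_num)
  norm_num at a0 a1 a2 a3 ⊢
  set s := Real.sin (3 * Real.pi / 4 - 8987 / 4000)
  set c := Real.cos (3 * Real.pi / 4 - 8987 / 4000)
  have b0 : 0 ≤ s := by linarith
  have b0' : 0 ≤ c := by linarith
  have b1 : s ≤ 0.109236 := by norm_num; linarith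
  have b2 : c ≤ 0.994020 := by norm_num; linarith
  have b3 : s * c ≤ (0.109236 : ℝ) * 0.994020 := by gcongr
  have b4 : s ^ 2 ≤ (0.109236 : ℝ) ^ 2 := by gcongr
  norm_num at b3 b4
  linarith

lemma exists_least_tan_eq_self :
    ∃ ρ : ℝ, IsLeast {x : ℝ | 0 < x ∧ Real.tan x = x} ρ ∧ 4.4933 < ρ ∧ ρ < 4.4935 ∧
      Real.sin ρ = ρ * Real.cos ρ := by
  have p1 := Real.pi_gt_d6
  have p2 := Real.pi_lt_d6
  norm_num at p1 p2
  obtain ⟨ρ, hρ, h0⟩ := intermediate_value_Ioo' (a := (4.4933 : ℝ)) (b := 4.4935) (by norm_num)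
    (f := fun y => Real.sin y - y * Real.cos y) (by fun_prop)
    ⟨sin_sub_mul_cos_neg_of_upper, sin_sub_mul_cos_pos_of_lower⟩
  have h0 : Real.sin ρ - ρ * Real.cos ρ = 0 := h0
  obtain ⟨l1, l2⟩ := hρ
  have n1 := l1
  have n2 := l2
  norm_num at n1 n2
  have hcos : Real.cos ρ ≠ 0 := fun h => by
    have h1 : Real.sin ρ = 0 := by rw [h] at h0; linarith
    have := Real.sin_sq_add_cos_sq ρ
    rw [h, h1] at this; norm_num at this
  refine ⟨ρ, ⟨⟨by linarith, ?_⟩, ?_⟩, l1, l2, by linarith⟩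
  · rw [Real.tan_eq_sin_div_cos, div_eq_iff hcos]; linarith
  · rintro x ⟨hx, htan⟩
    by_contra! hlt
    have hcx : Real.cos x ≠ 0 := fun h => by
      rw [Real.tan_eq_sin_div_cos, h, div_zero] at htan; exact hx.ne htan
    have hfx : Real.sin x - x * Real.cos x = 0 := by
      rw [Real.tan_eq_sin_div_cos, div_eq_iff hcx] at htan; linarith
    rcases le_total x Real.pi with h | h
    · have := sin_sub_mul_cos_strictMonoOn (a := 0) (b := x) ⟨le_rfl, Real.pi_pos.le⟩ ⟨hx.le, h⟩ hx
      simp only [Real.sin_zero, zero_mul, sub_zero] at this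
      linarith
    · have := sin_sub_mul_cos_strictAntiOn (a := x) (b := ρ) ⟨h, by linarith⟩
        ⟨by linarith, by linarith⟩ hlt
      simp only at this
      linarith

/-! ### Wirtinger's inequality -/

/-- Wirtinger's inequality for periodic functions of mean zero. The derivative is only a right
derivative, so that functions extended by zero are covered. -/
theorem wirtinger_of_mean_zero {a b : ℝ} (hab : a < b) {f f' : ℝ → ℝ}
    (hf : ContinuousOn f (Icc a b))
    (hff' : ∀ x ∈ Ioo a b, HasDerivWithinAt f (f' x) (Ioi x) x)
    (hf' : MemLp f' 2 (volume.restrict (Ioc a b))) (hper : f a = f b)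
    (hmean : ∫ x in a..b, f x = 0) :
    (2 * Real.pi / (b - a)) ^ 2 * ∫ x in a..b, f x ^ 2 ≤ ∫ x in a..b, f' x ^ 2 := by
  have hba : 0 < b - a := sub_pos.2 hab
  set F : ℝ → ℂ := fun x => (f x : ℂ)
  set F' : ℝ → ℂ := fun x => (f' x : ℂ)
  have hF2 : MemLp F 2 (volume.restrict (Ioc a b)) := by
    have hc : ContinuousOn F (Icc a b) := Complex.continuous_ofReal.comp_continuousOn hf
    obtain ⟨C, hC⟩ := isCompact_Icc.exists_bound_of_continuousOn hc
    refine MemLp.of_bound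
      ((hc.mono Ioc_subset_Icc_self).aestronglyMeasurable measurableSet_Ioc) C ?_
    exact (ae_restrict_iff' measurableSet_Ioc).2
      (Filter.Eventually.of_forall fun x hx => hC x (Ioc_subset_Icc_self hx))
  have hF'2 : MemLp F' 2 (volume.restrict (Ioc a b)) := hf'.ofReal
  have hint : IntervalIntegrable F' volume a b :=
    (intervalIntegrable_iff_integrableOn_Ioc_of_le hab.le).2 (hF'2.integrable (by norm_num))
  have key : ∀ n : ℤ, (2 * Real.pi / (b - a)) ^ 2 * ‖fourierCoeffOn hab F n‖ ^ 2
      ≤ ‖fourierCoeffOn hab F' n‖ ^ 2 := by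
    intro n
    rcases eq_or_ne n 0 with rfl | hn
    · have : fourierCoeffOn hab F 0 = 0 := by
        rw [fourierCoeffOn_eq_integral]
        simp only [neg_zero, fourier_zero, one_smul]
        have : ∫ x in a..b, F x = ((∫ x in a..b, f x : ℝ) : ℂ) := intervalIntegral.integral_ofReal
        rw [this, hmean]; simp
      rw [this]; simp
    · have := fourierCoeffOn_of_hasDeriv_right hab (f := F) (f' := F') hn
        (by rw [uIcc_of_le hab.le]; exact Complex.continuous_ofReal.comp_continuousOn hf)
        (by
          rw [min_eq_left hab.le, max_eq_right hab.le]
          exact fun x hx => (hff' x hx).ofReal_comp) hint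
      have hFab : F b - F a = 0 := by simp [F, hper]
      rw [this, hFab, mul_zero, zero_sub, norm_mul, norm_neg, norm_mul, norm_div]
      have e1 : ‖(-2 * (Real.pi : ℂ) * Complex.I * (n : ℂ))‖ = 2 * Real.pi * |(n : ℝ)| := by
        simp [abs_of_pos Real.pi_pos]
      have e2 : ‖((b : ℂ) - (a : ℂ))‖ = b - a := by
        rw [← Complex.ofReal_sub, Complex.norm_real, Real.norm_of_nonneg hba.le]
      rw [e1, e2, norm_one]
      have hn1 : (1 : ℝ) ≤ |(n : ℝ)| := by exact_mod_cast Int.one_le_abs hn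
      have hpi := Real.pi_pos
      have : (2 * Real.pi / (b - a)) ^ 2 *
          (1 / (2 * Real.pi * |(n : ℝ)|) * ((b - a) * ‖fourierCoeffOn hab F' n‖)) ^ 2
          = ‖fourierCoeffOn hab F' n‖ ^ 2 / |(n : ℝ)| ^ 2 := by
        have : |(n : ℝ)| ≠ 0 := by positivity
        field_simp
      rw [this]
      exact div_le_self (by positivity) (one_le_pow₀ hn1)
  have h := hasSum_le key ((hasSum_sq_fourierCoeffOn hab hF2).mul_left _)
    (hasSum_sq_fourierCoeffOn hab hF'2)
  simp only [F, F', Complex.norm_real, Real.norm_eq_abs, sq_abs, smul_eq_mul] at h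
  have hi : 0 < (b - a)⁻¹ := inv_pos.2 hba
  refine le_of_mul_le_mul_left ?_ hi
  linarith

/-! ### The energy on an initial interval of length `ρ` -/

/-- The constants of the extremal profile: `ρ` is the solution of `tan ρ = ρ` near `4.4934`,
`w = -1 / cos ρ = √(1 + ρ²)`, and `c` normalises the profile
`c (ρ² / 2 + 1 - x² / 2 + w cos x)` to have height `1` at `x = 0`. -/
structure ProfileConstants (ρ w c : ℝ) : Prop where
  lower : 4.4933 < ρ
  upper : ρ < 4.4935
  w_pos : 0 < w
  w_sq : w ^ 2 = 1 + ρ ^ 2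
  w_mul_cos : w * Real.cos ρ = -1
  w_mul_sin : w * Real.sin ρ = -ρ
  c_mul : c * (ρ ^ 2 / 2 + w + 1) = 1

namespace ProfileConstants

variable {ρ w c : ℝ}

lemma pos (P : ProfileConstants ρ w c) : 0 < ρ := lt_trans (by norm_num) P.lower

lemma le_two_pi (P : ProfileConstants ρ w c) : ρ ≤ 2 * Real.pi := by
  have h1 := P.upper
  have h2 := Real.pi_gt_three
  norm_num at h1
  linarith

lemma w_lower (P : ProfileConstants ρ w c) : 4.6 < w := by
  have h1 := P.lower
  have h2 := P.w_sq
  have h3 := P.w_pos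
  norm_num at h1 ⊢
  nlinarith

lemma w_upper (P : ProfileConstants ρ w c) : w < 4.61 := by
  have h1 := P.upper
  have h2 := P.w_sq
  have h3 := P.w_pos
  have h4 := P.pos
  norm_num at h1 ⊢
  nlinarith

lemma c_lower (P : ProfileConstants ρ w c) : 0.0636 < c := by
  have h1 := P.upper
  have h2 := P.w_upper
  have h4 := P.pos
  have h5 := P.w_pos
  have h6 : ρ ^ 2 < 4.4935 ^ 2 := by gcongr
  have h7 := P.c_mul
  norm_num at h1 h2 h6 ⊢
  by_contra! h
  have h8 : c * (ρ ^ 2 / 2 + w + 1) ≤ 159 / 2500 * (ρ ^ 2 / 2 + w + 1) := by gcongr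
  linarith

lemma c_upper (P : ProfileConstants ρ w c) : c < 0.0638 := by
  have h1 := P.lower
  have h2 := P.w_lower
  have h6 : (4.4933 : ℝ) ^ 2 < ρ ^ 2 := by gcongr
  have h5 := P.w_pos
  have h7 := P.c_mul
  norm_num at h1 h2 h6 ⊢
  by_contra! h
  have h8 : 319 / 5000 * (ρ ^ 2 / 2 + w + 1) ≤ c * (ρ ^ 2 / 2 + w + 1) := by gcongr
  linarith

lemma c_pos (P : ProfileConstants ρ w c) : 0 < c := lt_trans (by norm_num) P.c_lower

end ProfileConstants

/-- Lower bound for the energy `∫ φ''² - φ'² + 2 c m φ` on `[0, ρ]` in terms of the boundary data of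
`φ`. The difference of `φ'` and of the derivative `Ψ` of the solution of the Euler-Lagrange equation
with the same boundary data has mean zero and vanishes at the ends, so that Wirtinger's inequality
applies to it because `ρ ≤ 2π`. -/
theorem initial_energy_ge {ρ w c : ℝ} (P : ProfileConstants ρ w c) {φ ψ χ : ℝ → ℝ}
    (hφ : ContinuousOn φ (Icc 0 ρ)) (hψ : ContinuousOn ψ (Icc 0 ρ))
    (hφ' : ∀ x ∈ Ioo 0 ρ, HasDerivWithinAt φ (ψ x) (Ioi x) x)
    (hψ' : ∀ x ∈ Ioo 0 ρ, HasDerivWithinAt ψ (χ x) (Ioi x) x)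
    (hχ : MemLp χ 2 (volume.restrict (Ioc 0 ρ))) (hψ0 : ψ 0 = 0) :
    c ^ 2 * ρ ^ 3 / 3 * φ 0 ^ 2 + 2 * c * ρ * φ 0 * φ ρ - 2 * φ ρ * ψ ρ / (w + 1)
        - ρ * φ ρ ^ 2 / (w + 1) ^ 2
      ≤ ∫ x in (0 : ℝ)..ρ, (χ x ^ 2 - ψ x ^ 2 + 2 * c * φ 0 * φ x) := by
  have hρ := P.pos
  have hw := P.w_pos
  have hw1 : w + 1 ≠ 0 := by positivity
  set m := φ 0
  set p := φ ρ
  set s := ψ ρ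
  obtain ⟨M, hM⟩ : ∃ M, M = c * m := ⟨_, rfl⟩
  have hm : m = M * (ρ ^ 2 / 2 + w + 1) := by
    rw [hM]; linear_combination (-m) * P.c_mul
  obtain ⟨b, hb⟩ : ∃ b, b = ((w + 1) * s + ρ * p) / (w + 1) ^ 2 := ⟨_, rfl⟩
  obtain ⟨g, hg⟩ : ∃ g, g = (p - ρ * s) / (w + 1) := ⟨_, rfl⟩
  have hS : Real.sin ρ = -ρ / w := by rw [eq_div_iff hw.ne']; linarith [P.w_mul_sin]
  have hC : Real.cos ρ = -1 / w := by rw [eq_div_iff hw.ne']; linarith [P.w_mul_cos]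
  -- the solution of the Euler-Lagrange equation, its first two derivatives and a primitive
  set Φ : ℝ → ℝ := fun x => m - M * (x ^ 2 / 2 + w * (1 - Real.cos x)) + b * (x - Real.sin x)
    + g * (1 - Real.cos x) with hΦdef
  set Ψ : ℝ → ℝ := fun x => -M * (x + w * Real.sin x) + b * (1 - Real.cos x) + g * Real.sin x
    with hΨdef
  set Ψ' : ℝ → ℝ := fun x => -M * (1 + w * Real.cos x) + b * Real.sin x + g * Real.cos x
    with hΨ'def
  set Ψ'' : ℝ → ℝ := fun x => M * (w * Real.sin x) + b * Real.cos x - g * Real.sin x with hΨ''def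
  set I : ℝ → ℝ := fun x => m * x - M * (x ^ 3 / 6 + w * (x - Real.sin x))
    + b * (x ^ 2 / 2 - 1 + Real.cos x) + g * (x - Real.sin x) with hIdef
  have dsin := fun x => Real.hasDerivAt_sin x
  have dcos := fun x => Real.hasDerivAt_cos x
  have did := fun x : ℝ => hasDerivAt_id' x
  have dI : ∀ x, HasDerivAt I (Φ x) x := fun x => by
    have := ((((did x).const_mul m).sub (((((did x).pow 3).div_const 6).add
      (((did x).sub (dsin x)).const_mul w)).const_mul M)).add
      ((((((did x).pow 2).div_const 2).sub_const 1).add (dcos x)).const_mul b)).add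
      (((did x).sub (dsin x)).const_mul g)
    refine this.congr_deriv ?_
    simp only [hΦdef]; push_cast; ring
  have dΦ : ∀ x, HasDerivAt Φ (Ψ x) x := fun x => by
    have := ((((((did x).pow 2).div_const 2).add
      (((dcos x).const_sub 1).const_mul w)).const_mul M).const_sub m |>.add
      (((did x).sub (dsin x)).const_mul b)).add (((dcos x).const_sub 1).const_mul g)
    refine this.congr_deriv ?_
    simp only [hΨdef]; push_cast; ring
  have dΨ : ∀ x, HasDerivAt Ψ (Ψ' x) x := fun x => by
    have := (((did x).add ((dsin x).const_mul w)).const_mul (-M) |>.add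
      (((dcos x).const_sub 1).const_mul b)).add ((dsin x).const_mul g)
    refine this.congr_deriv ?_
    simp only [hΨ'def]; ring
  have dΨ' : ∀ x, HasDerivAt Ψ' (Ψ'' x) x := fun x => by
    have := ((((dcos x).const_mul w).const_add 1).const_mul (-M) |>.add
      ((dsin x).const_mul b)).add ((dcos x).const_mul g)
    refine this.congr_deriv ?_
    simp only [hΨ''def]; ring
  have EL : ∀ x, Ψ'' x + Ψ x = b - M * x := fun x => by
    simp only [hΨ''def, hΨdef]; ring
  have cΨ : Continuous Ψ := by fun_prop
  have cΨ' : Continuous Ψ' := by fun_prop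
  have cΦ : Continuous Φ := by fun_prop
  have cI : Continuous I := by fun_prop
  have hΦ0 : Φ 0 = m := by simp [hΦdef]
  have hΨ0 : Ψ 0 = 0 := by simp [hΨdef]
  have hI0 : I 0 = 0 := by simp [hIdef]
  have hw2 := P.w_sq
  have hΨρ : Ψ ρ = s := by
    simp only [hΨdef, hS, hC, hb, hg]; field_simp; grind
  have hΦρ : Φ ρ = p := by
    simp only [hΦdef, hS, hC, hb, hg, hm]; field_simp; grind
  have hΨ'ρ : Ψ' ρ = -p / (w + 1) := by
    simp only [hΨ'def, hS, hC, hb, hg]; field_simp; grind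
  -- Wirtinger's inequality for the difference
  have hmean : ∫ x in (0 : ℝ)..ρ, (ψ x - Ψ x) = 0 := by
    rw [intervalIntegral.integral_eq_sub_of_hasDeriv_right_of_le (f := fun x => φ x - Φ x) hρ.le
      (hφ.sub cΦ.continuousOn) (fun x hx => (hφ' x hx).sub (dΦ x).hasDerivWithinAt)
      ((hψ.sub cΨ.continuousOn).intervalIntegrable_of_Icc hρ.le), hΦρ, hΦ0]
    simp [p, m]
  have hΨ'2 : MemLp Ψ' 2 (volume.restrict (Ioc 0 ρ)) := by
    obtain ⟨C, hC⟩ := isCompact_Icc.exists_bound_of_continuousOn (cΨ'.continuousOn (s := Icc 0 ρ))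
    exact MemLp.of_bound cΨ'.aestronglyMeasurable C
      ((ae_restrict_iff' measurableSet_Ioc).2
      (Filter.Eventually.of_forall fun x hx => hC x (Ioc_subset_Icc_self hx)))
  have hW := wirtinger_of_mean_zero hρ (f := fun x => ψ x - Ψ x) (f' := fun x => χ x - Ψ' x)
    (hψ.sub cΨ.continuousOn) (fun x hx => (hψ' x hx).sub (dΨ x).hasDerivWithinAt)
    (hχ.sub hΨ'2) (by simp [hψ0, hΨ0, hΨρ, s]) hmean
  have hW' : ∫ x in (0 : ℝ)..ρ, (ψ x - Ψ x) ^ 2 ≤ ∫ x in (0 : ℝ)..ρ, (χ x - Ψ' x) ^ 2 := by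
    refine le_trans ?_ hW
    have h0 : 0 ≤ ∫ x in (0 : ℝ)..ρ, (ψ x - Ψ x) ^ 2 :=
      intervalIntegral.integral_nonneg hρ.le fun x _ => sq_nonneg _
    refine le_mul_of_one_le_left h0 (one_le_pow₀ ?_)
    rw [sub_zero, one_le_div hρ]
    exact P.le_two_pi
  -- the remaining part of the integrand is the derivative of `H`
  set H : ℝ → ℝ := fun x => 2 * (ψ x * Ψ' x) + 2 * M * (x * φ x) - 2 * b * φ x - Ψ x * Ψ' x
    - M * (x * Φ x) + b * Φ x + M * I x with hHdef
  have hH' : ∀ x ∈ Ioo 0 ρ, HasDerivWithinAt H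
      (2 * (χ x * Ψ' x) - Ψ' x ^ 2 - 2 * (ψ x * Ψ x) + Ψ x ^ 2 + 2 * M * φ x) (Ioi x) x := by
    intro x hx
    have e1 := hφ' x hx
    have e2 := hψ' x hx
    have e3 := (dΦ x).hasDerivWithinAt (s := Ioi x)
    have e4 := (dΨ x).hasDerivWithinAt (s := Ioi x)
    have e5 := (dΨ' x).hasDerivWithinAt (s := Ioi x)
    have e6 := (dI x).hasDerivWithinAt (s := Ioi x)
    have e7 := (did x).hasDerivWithinAt (s := Ioi x)
    have := (((((((e2.mul e5).const_mul 2).add ((e7.mul e1).const_mul (2 * M))).sub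
      (e1.const_mul (2 * b))).sub (e4.mul e5)).sub ((e7.mul e3).const_mul M)).add
      (e3.const_mul b)).add (e6.const_mul M)
    refine this.congr_deriv ?_
    linear_combination (2 * ψ x - Ψ x) * EL x
  have iχ : IntervalIntegrable χ volume 0 ρ :=
    (intervalIntegrable_iff_integrableOn_Ioc_of_le hρ.le).2 (hχ.integrable (by norm_num))
  have iχ2 : IntervalIntegrable (fun x => χ x ^ 2) volume 0 ρ :=
    (intervalIntegrable_iff_integrableOn_Ioc_of_le hρ.le).2 hχ.integrable_sq
  have iD : IntervalIntegrable (fun x => 2 * (χ x * Ψ' x) - Ψ' x ^ 2 - 2 * (ψ x * Ψ x) + Ψ x ^ 2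
      + 2 * M * φ x) volume 0 ρ := by
    have c1 : IntervalIntegrable (fun x => χ x * Ψ' x) volume 0 ρ :=
      iχ.mul_continuousOn cΨ'.continuousOn
    have c2 : IntervalIntegrable (fun x => -Ψ' x ^ 2 - 2 * (ψ x * Ψ x) + Ψ x ^ 2 + 2 * M * φ x)
        volume 0 ρ := by
      apply ContinuousOn.intervalIntegrable_of_Icc hρ.le
      fun_prop
    refine ((c1.const_mul 2).add c2).congr fun x _ => ?_
    ring
  have hFTC := intervalIntegral.integral_eq_sub_of_hasDeriv_right_of_le hρ.le
    (f := H) (by fun_prop) hH' iD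
  have i1 : IntervalIntegrable (fun x => (ψ x - Ψ x) ^ 2) volume 0 ρ := by
    apply ContinuousOn.intervalIntegrable_of_Icc hρ.le
    fun_prop
  have i2 : IntervalIntegrable (fun x => (χ x - Ψ' x) ^ 2) volume 0 ρ :=
    (intervalIntegrable_iff_integrableOn_Ioc_of_le hρ.le).2 (hχ.sub hΨ'2).integrable_sq
  have hsplit : ∫ x in (0 : ℝ)..ρ, (χ x ^ 2 - ψ x ^ 2 + 2 * c * m * φ x)
      = (H ρ - H 0) + ((∫ x in (0 : ℝ)..ρ, (χ x - Ψ' x) ^ 2)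
        - ∫ x in (0 : ℝ)..ρ, (ψ x - Ψ x) ^ 2) := by
    rw [← hFTC, ← intervalIntegral.integral_sub i2 i1, ← intervalIntegral.integral_add iD
      (i2.sub i1)]
    refine intervalIntegral.integral_congr fun x _ => ?_
    simp only [hM]; ring
  have hval : H ρ - H 0 = c ^ 2 * ρ ^ 3 / 3 * m ^ 2 + 2 * c * ρ * m * p - 2 * p * s / (w + 1)
      - ρ * p ^ 2 / (w + 1) ^ 2 := by
    have e1 : H ρ - H 0 = s * (-p / (w + 1)) + M * ρ * p - b * p + b * m + M * I ρ := by
      simp only [hHdef, hΨρ, hΨ'ρ, hΦρ, hI0, hΦ0, hΨ0, hψ0]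
      ring
    have e2 : M ^ 2 * ρ ^ 3 / 3 + 2 * M * ρ * p = c ^ 2 * ρ ^ 3 / 3 * m ^ 2 + 2 * c * ρ * m * p := by
      rw [hM]; ring
    rw [e1, ← e2]
    simp only [hIdef, hS, hC]
    clear_value m p s
    clear * - hm hb hg hw2 hw hw1
    subst hb hg hm
    field_simp
    grind
  rw [hsplit, hval]
  linarith

/-- The energy of a function between two critical points at distance at most `ρ`, obtained by
extending the function, shifted to vanish at the second point, by zero. -/
theorem energy_between_critical_ge {ρ w c : ℝ} (P : ProfileConstants ρ w c) {φ ψ χ : ℝ → ℝ}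
    (hφ : ∀ x, HasDerivAt φ (ψ x) x) (hψ : ∀ x, HasDerivAt ψ (χ x) x) (hχ : Continuous χ)
    {Y : ℝ} (hY0 : 0 ≤ Y) (hY : Y ≤ ρ) (h0 : ψ 0 = 0) (h1 : ψ Y = 0) :
    c ^ 2 * ρ ^ 3 / 3 * (φ 0 - φ Y) ^ 2
      ≤ ∫ x in (0 : ℝ)..Y, (χ x ^ 2 - ψ x ^ 2 + 2 * c * (φ 0 - φ Y) * (φ x - φ Y)) := by
  have cφ : Continuous φ := continuous_iff_continuousAt.2 fun x => (hφ x).continuousAt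
  have cψ : Continuous ψ := continuous_iff_continuousAt.2 fun x => (hψ x).continuousAt
  set Φ : ℝ → ℝ := fun x => φ (min x Y) - φ Y with hΦ
  set Ψ : ℝ → ℝ := fun x => ψ (min x Y) with hΨ
  set X : ℝ → ℝ := fun x => if x < Y then χ x else 0 with hX
  have hright : ∀ {f f' : ℝ → ℝ}, (∀ x, HasDerivAt f (f' x) x) → ∀ x,
      HasDerivWithinAt (fun x => f (min x Y)) (if x < Y then f' x else 0) (Ioi x) x := by
    intro f f' hf x
    split_ifs with hx
    · refine ((hf x).congr_of_eventuallyEq ?_).hasDerivWithinAt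
      filter_upwards [Iio_mem_nhds hx] with y hy
      rw [min_eq_left (le_of_lt hy)]
    · push Not at hx
      refine (hasDerivWithinAt_const x (Ioi x) (f Y)).congr (fun y hy => ?_) ?_
      · rw [min_eq_right (hx.trans (le_of_lt hy))]
      · rw [min_eq_right hx]
  have hXm : MemLp X 2 (volume.restrict (Ioc 0 ρ)) := by
    obtain ⟨C, hC⟩ := isCompact_Icc.exists_bound_of_continuousOn (hχ.continuousOn (s := Icc 0 Y))
    have hC0 : 0 ≤ C := (norm_nonneg _).trans (hC 0 ⟨le_rfl, hY0⟩)
    refine MemLp.of_bound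
      (Measurable.ite measurableSet_Iio hχ.measurable measurable_const).aestronglyMeasurable C ?_
    refine (ae_restrict_iff' measurableSet_Ioc).2 (Filter.Eventually.of_forall fun x hx => ?_)
    by_cases h : x < Y
    · simp only [hX, h, if_true]; exact hC x ⟨hx.1.le, h.le⟩
    · simp only [hX, h, if_false]; simpa using hC0
  have key := initial_energy_ge P (φ := Φ) (ψ := Ψ) (χ := X) (by fun_prop) (by fun_prop)
    (fun x _ => ?_) (fun x _ => hright hψ x) hXm (by simp [hΨ, hY0, h0])
  · have e1 : Φ ρ = 0 := by simp [hΦ, hY]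
    have e2 : Φ 0 = φ 0 - φ Y := by simp [hΦ, hY0]
    rw [e1, e2] at key
    simp only [mul_zero, zero_mul, zero_div, sub_zero, add_zero, ne_eq, OfNat.ofNat_ne_zero,
      not_false_eq_true, zero_pow] at key
    refine key.trans (le_of_eq ?_)
    have hE : ∀ x ∈ Ioo 0 Y, X x ^ 2 - Ψ x ^ 2 + 2 * c * (φ 0 - φ Y) * Φ x
        = χ x ^ 2 - ψ x ^ 2 + 2 * c * (φ 0 - φ Y) * (φ x - φ Y) := fun x hx => by
      simp [hX, hΨ, hΦ, hx.2, hx.2.le]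
    have hE' : ∀ x ∈ uIcc Y ρ, X x ^ 2 - Ψ x ^ 2 + 2 * c * (φ 0 - φ Y) * Φ x = 0 := fun x hx => by
      rw [uIcc_of_le hY] at hx
      simp [hX, hΨ, hΦ, not_lt.2 hx.1, hx.1, h1]
    have i1 : IntervalIntegrable
        (fun x => X x ^ 2 - Ψ x ^ 2 + 2 * c * (φ 0 - φ Y) * Φ x) volume 0 ρ := by
      refine IntervalIntegrable.add (IntervalIntegrable.sub ?_ ?_) ?_
      · exact (intervalIntegrable_iff_integrableOn_Ioc_of_le P.pos.le).2 hXm.integrable_sq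
      · exact Continuous.intervalIntegrable (by fun_prop) _ _
      · exact Continuous.intervalIntegrable (by fun_prop) _ _
    rw [← intervalIntegral.integral_add_adjacent_intervals (b := Y)
      (i1.mono_set (by rw [uIcc_of_le hY0, uIcc_of_le P.pos.le]; exact Icc_subset_Icc_right hY))
      (i1.mono_set (by rw [uIcc_of_le hY, uIcc_of_le P.pos.le]; exact Icc_subset_Icc_left hY0)),
      intervalIntegral.integral_congr hE', intervalIntegral.integral_zero, add_zero,
      intervalIntegral.integral_of_le hY0, intervalIntegral.integral_of_le hY0,
      integral_Ioc_eq_integral_Ioo, integral_Ioc_eq_integral_Ioo]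
    exact setIntegral_congr_fun measurableSet_Ioo hE
  · have := (hright hφ x).sub_const (φ Y)
    refine this.congr_deriv ?_
    simp only [hΨ]
    split_ifs with hx
    · rw [min_eq_left hx.le]
    · rw [min_eq_right (not_lt.1 hx), h1]

/-! ### Short intervals between critical points -/

/-- On an interval of length at most `2` at whose ends `φ'` vanishes, half of `∫ φ''²` dominates
`∫ φ'²` (with the multiplier `κ = -√2 tan (√2 (x - Y/2))`, which solves `κ' + κ² = -2`), and the other
half controls the square of the height difference. -/
theorem short_interval_energy_ge {φ ψ χ : ℝ → ℝ}
    (hφ : ∀ x, HasDerivAt φ (ψ x) x) (hψ : ∀ x, HasDerivAt ψ (χ x) x) (hχ : Continuous χ)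
    {Y : ℝ} (hY0 : 0 < Y) (hY : Y ≤ 2) (h0 : ψ 0 = 0) (h1 : ψ Y = 0) :
    6 * (φ 0 - φ Y) ^ 2 / Y ^ 3 ≤ ∫ x in (0 : ℝ)..Y, (χ x ^ 2 - ψ x ^ 2) := by
  have cφ : Continuous φ := continuous_iff_continuousAt.2 fun x => (hφ x).continuousAt
  have cψ : Continuous ψ := continuous_iff_continuousAt.2 fun x => (hψ x).continuousAt
  obtain ⟨q, hq0, hq⟩ : ∃ q : ℝ, 0 < q ∧ q ^ 2 = 2 := ⟨√2, by positivity, by norm_num⟩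
  have hq1 : q < 1.42 := by nlinarith
  set l : ℝ := 12 * (φ 0 - φ Y) / Y ^ 3 with hl
  set κ : ℝ → ℝ := fun x => -q * Real.tan (q * (x - Y / 2)) with hκ
  have dκ : ∀ x ∈ Icc 0 Y, HasDerivAt κ (-2 - κ x ^ 2) x := by
    intro x hx
    have hcos : Real.cos (q * (x - Y / 2)) ≠ 0 := by
      refine (Real.cos_pos_of_mem_Ioo ⟨?_, ?_⟩).ne'
      · have := Real.pi_gt_three
        nlinarith [hx.1]
      · have := Real.pi_gt_three
        nlinarith [hx.2]
    have h := (((Real.hasDerivAt_tan hcos).comp x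
      (((hasDerivAt_id' x).sub_const (Y / 2)).const_mul q))).const_mul (-q)
    refine h.congr_deriv ?_
    simp only [hκ, Real.tan_eq_sin_div_cos]
    clear h
    generalize q * (x - Y / 2) = θ at hcos ⊢
    have := Real.sin_sq_add_cos_sq θ
    field_simp
    linear_combination q ^ 2 * this - Real.cos θ ^ 2 * hq
  set g : ℝ → ℝ := fun x => κ x * ψ x ^ 2 / 2 + l * (ψ x * (x - Y / 2)) - l * φ x
    - l ^ 2 * (x - Y / 2) ^ 3 / 6 with hg
  have dg : ∀ x ∈ Icc 0 Y, HasDerivAt g ((-2 - κ x ^ 2) * ψ x ^ 2 / 2 + κ x * ψ x * χ x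
      + l * (χ x * (x - Y / 2)) - l ^ 2 * (x - Y / 2) ^ 2 / 2) x := by
    intro x hx
    have d1 := (hasDerivAt_id' x).sub_const (Y / 2)
    have h := (((((dκ x hx).mul ((hψ x).pow 2)).div_const 2).add
      (((hψ x).mul d1).const_mul l)).sub ((hφ x).const_mul l)).sub
      (((d1.pow 3).const_mul (l ^ 2)).div_const 6)
    refine h.congr_deriv ?_
    simp only [Pi.pow_apply]
    push_cast
    ring
  have h := intervalIntegral.sub_le_integral_of_hasDeriv_right_of_le hY0.le
    (fun x hx => (dg x hx).continuousAt.continuousWithinAt)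
    (fun x hx => (dg x (Ioo_subset_Icc_self hx)).hasDerivWithinAt)
    (φ := fun x => χ x ^ 2 - ψ x ^ 2)
    ((by fun_prop : Continuous fun x => χ x ^ 2 - ψ x ^ 2).integrableOn_Icc) (fun x _ => ?_)
  · refine le_trans (le_of_eq ?_) h
    simp only [hg, h0, h1, hl]
    field_simp
    ring
  · nlinarith [sq_nonneg (χ x - κ x * ψ x), sq_nonneg (χ x - l * (x - Y / 2))]

/-! ### A calibration of the energy -/

/-- A calibration of the energy density: along any function `φ` with `0 ≤ φ ≤ m`, the density
`φ''² - φ'² + 2 c m φ` is at least minus the derivative of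
`(3/5) (φ + k) φ' - (4/9) φ'³ / (φ + k)`, up to an error that vanishes as `k → 0`. -/
theorem calibrated_energy_ge {ρ w c : ℝ} (P : ProfileConstants ρ w c) {φ ψ χ : ℝ → ℝ}
    (hφ : ∀ x, HasDerivAt φ (ψ x) x) (hψ : ∀ x, HasDerivAt ψ (χ x) x) (hχ : Continuous χ)
    {a b m k : ℝ} (hab : a ≤ b) (h0 : ∀ x ∈ Icc a b, 0 ≤ φ x) (hm : ∀ x ∈ Icc a b, φ x ≤ m)
    (hk : 0 < k) (hkm : k ≤ m / 10) :
    (3 / 5 * (φ a + k) * ψ a - 4 / 9 * ψ a ^ 3 / (φ a + k))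
      - (3 / 5 * (φ b + k) * ψ b - 4 / 9 * ψ b ^ 3 / (φ b + k)) - 9 / 100 * k ^ 2 * (b - a)
      ≤ ∫ x in a..b, (χ x ^ 2 - ψ x ^ 2 + 2 * c * m * φ x) := by
  have cφ : Continuous φ := continuous_iff_continuousAt.2 fun x => (hφ x).continuousAt
  have cψ : Continuous ψ := continuous_iff_continuousAt.2 fun x => (hψ x).continuousAt
  have hc := P.c_lower
  set g : ℝ → ℝ := fun x => 4 / 9 * ψ x ^ 3 / (φ x + k) - 3 / 5 * ((φ x + k) * ψ x)
    - 9 / 100 * k ^ 2 * x with hg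
  have hv : ∀ x ∈ Icc a b, 0 < φ x + k := fun x hx => add_pos_of_nonneg_of_pos (h0 x hx) hk
  have dg : ∀ x ∈ Icc a b, HasDerivAt g (4 / 3 * ψ x ^ 2 * χ x / (φ x + k)
      - 4 / 9 * (ψ x ^ 2 / (φ x + k)) ^ 2 - 3 / 5 * (ψ x ^ 2 + (φ x + k) * χ x)
      - 9 / 100 * k ^ 2) x := by
    intro x hx
    have hv' := (hv x hx).ne'
    have h := (((((hψ x).pow 3).const_mul (4 / 9)).div ((hφ x).add_const k) hv').sub
      ((((hφ x).add_const k).mul (hψ x)).const_mul (3 / 5))).sub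
      ((hasDerivAt_id' x).const_mul (9 / 100 * k ^ 2))
    refine h.congr_deriv ?_
    simp only [Pi.pow_apply]
    push_cast
    field_simp
    ring
  have h := intervalIntegral.sub_le_integral_of_hasDeriv_right_of_le hab
    (fun x hx => (dg x hx).continuousAt.continuousWithinAt)
    (fun x hx => (dg x (Ioo_subset_Icc_self hx)).hasDerivWithinAt)
    (φ := fun x => χ x ^ 2 - ψ x ^ 2 + 2 * c * m * φ x)
    ((by fun_prop : Continuous fun x => χ x ^ 2 - ψ x ^ 2 + 2 * c * m * φ x).integrableOn_Icc)
    (fun x hx => ?_)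
  · refine le_trans (le_of_eq ?_) h
    simp only [hg]
    ring
  · have hx' := Ioo_subset_Icc_self hx
    have hv' := (hv x hx').ne'
    have e0 := h0 x hx'
    have e1 := hm x hx'
    obtain ⟨X, hX⟩ : ∃ X, X = ψ x ^ 2 / (φ x + k) := ⟨_, rfl⟩
    have e2 : 4 / 3 * ψ x ^ 2 * χ x / (φ x + k) = 4 / 3 * X * χ x := by rw [hX]; ring
    have e3 : ψ x ^ 2 = X * (φ x + k) := by rw [hX]; field_simp
    rw [e2, ← hX, e3]
    have hmφ : φ x * φ x ≤ m * φ x := by gcongr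
    have hkφ : k * φ x ≤ m / 10 * φ x := by gcongr
    have hcm : 0.0636 * (m * φ x) ≤ c * (m * φ x) := by
      have : 0 ≤ m * φ x := mul_nonneg (e0.trans e1) e0
      gcongr
    have := sq_nonneg (χ x + 3 / 10 * (φ x + k) - 2 / 3 * X)
    norm_num at hcm
    nlinarith

/-- The energy between two critical points is nonnegative. -/
theorem energy_between_critical_nonneg {ρ w c : ℝ} (P : ProfileConstants ρ w c) {φ ψ χ : ℝ → ℝ}
    (hφ : ∀ x, HasDerivAt φ (ψ x) x) (hψ : ∀ x, HasDerivAt ψ (χ x) x) (hχ : Continuous χ)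
    {a b m : ℝ} (hab : a ≤ b) (h0 : ∀ x ∈ Icc a b, 0 ≤ φ x) (hm : ∀ x ∈ Icc a b, φ x ≤ m)
    (hm0 : 0 < m) (ha : ψ a = 0) (hb : ψ b = 0) :
    0 ≤ ∫ x in a..b, (χ x ^ 2 - ψ x ^ 2 + 2 * c * m * φ x) := by
  have hlim : Filter.Tendsto (fun k : ℝ => -(9 / 100 * k ^ 2 * (b - a))) (nhdsWithin 0 (Ioi 0))
      (nhds 0) := by
    have : Continuous fun k : ℝ => -(9 / 100 * k ^ 2 * (b - a)) := by fun_prop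
    simpa using (this.tendsto 0).mono_left nhdsWithin_le_nhds
  refine le_of_tendsto hlim ?_
  filter_upwards [Ioo_mem_nhdsGT (show (0 : ℝ) < m / 10 by positivity)] with k hk
  have := calibrated_energy_ge P hφ hψ hχ hab h0 hm hk.1 hk.2.le
  simpa [ha, hb] using this

/-! ### The energy on a half-line -/

/-- Energy of a descent from a critical point to a lower critical point at distance at most `ρ`. -/
theorem descent_energy_ge {ρ w c : ℝ} (P : ProfileConstants ρ w c) {φ ψ χ : ℝ → ℝ}
    (hφ : ∀ x, HasDerivAt φ (ψ x) x) (hψ : ∀ x, HasDerivAt ψ (χ x) x) (hχ : Continuous χ)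
    {Y : ℝ} (hY0 : 0 ≤ Y) (hY : Y ≤ ρ) (h0 : ψ 0 = 0) (h1 : ψ Y = 0) (hl0 : 0 ≤ φ Y)
    (hlow : ∀ x ∈ Icc 0 Y, φ Y ≤ φ x) :
    c ^ 2 * ρ ^ 3 / 3 * (φ 0 ^ 2 - φ Y ^ 2)
      ≤ ∫ x in (0 : ℝ)..Y, (χ x ^ 2 - ψ x ^ 2 + 2 * c * φ 0 * φ x) := by
  have cφ : Continuous φ := continuous_iff_continuousAt.2 fun x => (hφ x).continuousAt
  have cψ : Continuous ψ := continuous_iff_continuousAt.2 fun x => (hψ x).continuousAt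
  have c0 := P.c_pos
  have cl := P.c_lower
  have cu := P.c_upper
  have ρ0 := P.pos
  have hρ3 : ρ ^ 3 < 4.4935 ^ 3 := pow_lt_pow_left₀ P.upper ρ0.le (by norm_num)
  norm_num at cl cu hρ3
  have hlm := hlow 0 ⟨le_rfl, hY0⟩
  rcases le_or_gt Y 2 with hY2 | hY2
  · rcases hY0.eq_or_lt with rfl | hYpos
    · simp
    -- a short interval: only the constant lower bound of the linear term is needed
    have hs := short_interval_energy_ge hφ hψ hχ hYpos hY2 h0 h1
    have hlin : Y * (2 * c * φ 0 * φ Y) ≤ ∫ x in (0 : ℝ)..Y, 2 * c * φ 0 * φ x := by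
      have : ∫ x in (0 : ℝ)..Y, 2 * c * φ 0 * φ Y = Y * (2 * c * φ 0 * φ Y) := by
        rw [intervalIntegral.integral_const, smul_eq_mul, sub_zero]
      rw [← this]
      refine intervalIntegral.integral_mono_on hY0 (by simp)
        (Continuous.intervalIntegrable (by fun_prop) _ _) fun x hx => ?_
      have : 0 ≤ 2 * c * φ 0 := by have := hl0.trans hlm; positivity
      exact mul_le_mul_of_nonneg_left (hlow x hx) this
    rw [intervalIntegral.integral_add (Continuous.intervalIntegrable (by fun_prop) _ _)
      (Continuous.intervalIntegrable (by fun_prop) _ _)]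
    refine le_trans ?_ (add_le_add hs hlin)
    generalize φ 0 = m at *
    generalize φ Y = l at *
    obtain ⟨d, rfl⟩ : ∃ d, m = l + d := ⟨m - l, by ring⟩
    have hd : 0 ≤ d := by linarith
    have hk : c ^ 2 * ρ ^ 3 / 3 ≤ 0.1232 := by
      have : c ^ 2 ≤ (319 / 5000) ^ 2 := by gcongr
      calc c ^ 2 * ρ ^ 3 / 3 ≤ (319 / 5000) ^ 2 * (725845560803 / 8000000000) / 3 := by gcongr
        _ ≤ _ := by norm_num
    have hm2 : (l + d) ^ 2 - l ^ 2 = d * (2 * l + d) := by ring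
    have e1 : c ^ 2 * ρ ^ 3 / 3 * ((l + d) ^ 2 - l ^ 2) ≤ 0.1232 * (d * (2 * l + d)) := by
      rw [hm2]; gcongr
    have e2 : 0.127 * (Y * ((l + d) * l)) ≤ Y * (2 * c * (l + d) * l) := by
      have : 0 ≤ Y * ((l + d) * l) := by positivity
      norm_num
      nlinarith
    have e3 : 6 * (l + d - l) ^ 2 / Y ^ 3 = 6 * d ^ 2 / Y ^ 3 := by ring_nf
    rw [e3]
    refine e1.trans (le_trans ?_ (add_le_add_right e2 _))
    -- with `t = d / Y`, the sum is at least `6 t² / Y + …`, and `Y ≤ 2`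
    obtain ⟨t, rfl⟩ : ∃ t, d = t * Y := ⟨d / Y, by field_simp⟩
    have ht : 0 ≤ t := nonneg_of_mul_nonneg_left hd hYpos
    have e4 : 6 * (t * Y) ^ 2 / Y ^ 3 = 6 * t ^ 2 / Y := by field_simp
    rw [e4]
    have e5 : 0.1232 * (t * Y * (2 * l + t * Y)) - 0.127 * (Y * ((l + t * Y) * l))
        ≤ 6 * t ^ 2 / Y := by
      rw [le_div_iff₀ hYpos]
      have f1 : t * (Y * l) * Y ≤ t * (Y * l) * 2 := by gcongr
      have f2 : t ^ 2 * Y ^ 3 ≤ t ^ 2 * 2 ^ 3 := by gcongr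
      have f3 : 0 ≤ t * Y * (Y * (Y * l)) := by positivity
      norm_num
      nlinarith [sq_nonneg (5 * t - Y * l), sq_nonneg t, sq_nonneg (Y * l)]
    linarith
  · have hb := energy_between_critical_ge P hφ hψ hχ hY0 hY h0 h1
    have hsplit : ∫ x in (0 : ℝ)..Y, (χ x ^ 2 - ψ x ^ 2 + 2 * c * φ 0 * φ x)
        = (∫ x in (0 : ℝ)..Y, (χ x ^ 2 - ψ x ^ 2 + 2 * c * (φ 0 - φ Y) * (φ x - φ Y)))
          + ∫ x in (0 : ℝ)..Y, (2 * c * φ Y * (φ x - φ Y) + 2 * c * φ 0 * φ Y) := by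
      rw [← intervalIntegral.integral_add (Continuous.intervalIntegrable (by fun_prop) _ _)
        (Continuous.intervalIntegrable (by fun_prop) _ _)]
      refine intervalIntegral.integral_congr fun x _ => ?_
      ring
    have hlin : Y * (2 * c * φ 0 * φ Y)
        ≤ ∫ x in (0 : ℝ)..Y, (2 * c * φ Y * (φ x - φ Y) + 2 * c * φ 0 * φ Y) := by
      have : ∫ x in (0 : ℝ)..Y, 2 * c * φ 0 * φ Y = Y * (2 * c * φ 0 * φ Y) := by
        rw [intervalIntegral.integral_const, smul_eq_mul, sub_zero]
      rw [← this]
      refine intervalIntegral.integral_mono_on hY0 (by simp)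
        (Continuous.intervalIntegrable (by fun_prop) _ _) fun x hx => ?_
      have : 0 ≤ 2 * c * φ Y * (φ x - φ Y) :=
        mul_nonneg (by positivity) (sub_nonneg.2 (hlow x hx))
      linarith
    rw [hsplit]
    refine le_trans ?_ (add_le_add hb hlin)
    generalize φ 0 = m at *
    generalize φ Y = l at *
    have hk : c * ρ ^ 3 / 3 ≤ 2 := by
      calc c * ρ ^ 3 / 3 ≤ (319 / 5000) * (725845560803 / 8000000000) / 3 := by gcongr
        _ ≤ _ := by norm_num
    have e1 : c * ρ ^ 3 / 3 * (2 * c * l * (m - l)) ≤ 2 * (2 * c * l * (m - l)) := by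
      have : 0 ≤ 2 * c * l * (m - l) := mul_nonneg (by positivity) (by linarith)
      gcongr
    have e2 : 2 * (2 * c * l * m) ≤ Y * (2 * c * l * m) := by
      have : 0 ≤ 2 * c * l * m := mul_nonneg (by positivity) (by linarith)
      gcongr
    have e3 : 0 ≤ 2 * (2 * c * l * l) := by positivity
    nlinarith

lemma hasDerivAt_nonpos_of_le_left {f : ℝ → ℝ} {d a x : ℝ} (h : HasDerivAt f d x) (hax : a < x)
    (hmin : ∀ y ∈ Icc a x, f x ≤ f y) : d ≤ 0 := by
  have ht := (hasDerivAt_iff_tendsto_slope.1 h).mono_left (nhdsLT_le_nhdsNE x)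
  refine le_of_tendsto ht ?_
  filter_upwards [Ioo_mem_nhdsLT hax] with y hy
  rw [slope_def_field]
  exact div_nonpos_of_nonneg_of_nonpos (sub_nonneg.2 (hmin y (Ioo_subset_Icc_self hy)))
    (sub_nonpos.2 hy.2.le)

lemma hasDerivAt_nonpos_of_le_right {f : ℝ → ℝ} {d x b : ℝ} (h : HasDerivAt f d x) (hxb : x < b)
    (hmax : ∀ y ∈ Icc x b, f y ≤ f x) : d ≤ 0 := by
  have ht := (hasDerivAt_iff_tendsto_slope.1 h).mono_left (nhdsGT_le_nhdsNE x)
  refine le_of_tendsto ht ?_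
  filter_upwards [Ioo_mem_nhdsGT hxb] with y hy
  rw [slope_def_field]
  exact div_nonpos_of_nonpos_of_nonneg (sub_nonpos.2 (hmax y (Ioo_subset_Icc_self hy)))
    (sub_nonneg.2 hy.1.le)

lemma deriv_eq_zero_of_eq_zero_beyond {f : ℝ → ℝ} {t : ℝ} (h : ∀ x, t < x → f x = 0) :
    ∀ x, t < x → deriv f x = 0 := fun x hx => by
  have : f =ᶠ[nhds x] fun _ => 0 := by
    filter_upwards [Ioi_mem_nhds hx] with y hy using h y hy
  rw [this.deriv_eq]; simp

section

variable {φ : ℝ → ℝ}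

lemma hasDerivAt_deriv_of_contDiff_two (hs : ContDiff ℝ 2 φ) (x : ℝ) :
    HasDerivAt φ (deriv φ x) x :=
  ((hs.differentiable (by norm_num)) x).hasDerivAt

lemma contDiff_one_deriv (hs : ContDiff ℝ 2 φ) : ContDiff ℝ 1 (deriv φ) := by
  have : ContDiff ℝ (1 + 1) φ := by convert hs using 1; norm_num
  exact (contDiff_succ_iff_deriv.1 this).2.2

lemma hasDerivAt_deriv_deriv (hs : ContDiff ℝ 2 φ) (x : ℝ) :
    HasDerivAt (deriv φ) (deriv (deriv φ) x) x :=
  (((contDiff_one_deriv hs).differentiable (by norm_num)) x).hasDerivAt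

lemma continuous_deriv_deriv (hs : ContDiff ℝ 2 φ) : Continuous (deriv (deriv φ)) :=
  (contDiff_one_deriv hs).continuous_deriv (by norm_num)

lemma integrable_deriv_deriv_sq (hs : ContDiff ℝ 2 φ) (hcs : HasCompactSupport φ) :
    Integrable fun x => deriv (deriv φ) x ^ 2 :=
  ((continuous_deriv_deriv hs).pow 2).integrable_of_hasCompactSupport
    (by simpa [pow_two] using hcs.deriv.deriv.mul_left (f := deriv (deriv φ)))

lemma integrable_deriv_sq (hs : ContDiff ℝ 2 φ) (hcs : HasCompactSupport φ) :
    Integrable fun x => deriv φ x ^ 2 :=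
  ((contDiff_one_deriv hs).continuous.pow 2).integrable_of_hasCompactSupport
    (by simpa [pow_two] using hcs.deriv.mul_left (f := deriv φ))

lemma integrable_energy_density (hs : ContDiff ℝ 2 φ) (hcs : HasCompactSupport φ) (a : ℝ) :
    Integrable fun x => deriv (deriv φ) x ^ 2 - deriv φ x ^ 2 + a * φ x :=
  ((integrable_deriv_deriv_sq hs hcs).sub (integrable_deriv_sq hs hcs)).add
    ((hs.continuous.integrable_of_hasCompactSupport hcs).const_mul a)

end

/-- The real inequality that closes the comparison when the function still decreases at distance
`ρ` from its maximum `m`; `p` is its value there, `s` minus its slope and `k` the regularisation of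
the calibration. -/
lemma matching_inequality {ρ w c : ℝ} (P : ProfileConstants ρ w c) {m p s k : ℝ}
    (hp : 0 ≤ p) (hpm : p ≤ m) (hs : 0 ≤ s) (hk : 0 < k) :
    -(k * (0.33 * s + 0.162 * p + 0.081 * k)) ≤ 2 * c * ρ * m * p - 2 * p * -s / (w + 1)
        - ρ * p ^ 2 / (w + 1) ^ 2 + (3 / 5 * (p + k) * -s - 4 / 9 * (-s) ^ 3 / (p + k)) := by
  have wl := P.w_lower
  have wu := P.w_upper
  have cl := P.c_lower
  have ρl := P.lower
  have ρu := P.upper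
  have hw := P.w_pos
  have hc := P.c_pos
  norm_num at wl wu cl ρl ρu
  have e1 : 0.356 * (p * s) ≤ 2 * p * s / (w + 1) := by
    rw [le_div_iff₀ (by positivity)]
    have : p * s * w ≤ p * s * (461 / 100) := by gcongr
    norm_num
    nlinarith [mul_nonneg hp hs]
  have e2 : ρ * p ^ 2 / (w + 1) ^ 2 ≤ 0.144 * p ^ 2 := by
    rw [div_le_iff₀ (by positivity)]
    have h1 : (28 / 5 : ℝ) ^ 2 ≤ (w + 1) ^ 2 := by gcongr; linarith
    have h2 : ρ * p ^ 2 ≤ 8987 / 2000 * p ^ 2 := by gcongr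
    have h3 : p ^ 2 * (28 / 5) ^ 2 ≤ p ^ 2 * (w + 1) ^ 2 := by gcongr
    norm_num
    nlinarith
  have e3 : 0.571 * p ^ 2 ≤ 2 * c * ρ * m * p := by
    have h1 : (0.571 : ℝ) ≤ 2 * c * ρ := by
      have : (159 / 2500 : ℝ) * (44933 / 10000) ≤ c * ρ := by gcongr
      norm_num
      linarith
    calc 0.571 * p ^ 2 ≤ 2 * c * ρ * p ^ 2 := by gcongr
      _ = 2 * c * ρ * p * p := by ring
      _ ≤ 2 * c * ρ * m * p := by gcongr
  have hv : 0 < p + k := by positivity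
  -- the tangent of `s³` at `s = 0.45 (p + k)`
  have e4 : 0.27 * s * (p + k) - 0.081 * (p + k) ^ 2 ≤ 4 / 9 * s ^ 3 / (p + k) := by
    rw [le_div_iff₀ hv]
    have : 0 ≤ (s - 0.45 * (p + k)) ^ 2 * (s + 0.9 * (p + k)) := by positivity
    norm_num at this ⊢
    nlinarith
  have e5 : 4 / 9 * (-s) ^ 3 / (p + k) = -(4 / 9 * s ^ 3 / (p + k)) := by ring
  have e8 : 2 * p * -s / (w + 1) = -(2 * p * s / (w + 1)) := by ring
  rw [e5, e8]
  have e6 : 0 ≤ p * s := by positivity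
  have e7 : 0 ≤ p ^ 2 := by positivity
  norm_num at e1 e2 e3 e4 ⊢
  nlinarith

/-- Lower bound for the energy to the right of a critical point that is the maximum on its right.
If the function still decreases at distance `ρ`, the bound on the initial interval is matched with
the calibration. Otherwise the function has a minimum within distance `ρ`, and the bound follows from
the one at the later maximum; the induction is on the length of the support. -/
theorem half_line_energy_ge_aux {ρ w c : ℝ} (P : ProfileConstants ρ w c) {φ : ℝ → ℝ}
    (hs : ContDiff ℝ 2 φ) (hcs : HasCompactSupport φ) (hpos : ∀ x, 0 ≤ φ x) (n : ℕ) :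
    ∀ x₀, (∀ x, x₀ + n * ρ ≤ x → φ x = 0) → deriv φ x₀ = 0 → (∀ x, x₀ ≤ x → φ x ≤ φ x₀) →
    c ^ 2 * ρ ^ 3 / 3 * φ x₀ ^ 2
      ≤ ∫ x in Ioi x₀, (deriv (deriv φ) x ^ 2 - deriv φ x ^ 2 + 2 * c * φ x₀ * φ x) := by
  have dφ := hasDerivAt_deriv_of_contDiff_two hs
  have dψ := hasDerivAt_deriv_deriv hs
  have cχ := continuous_deriv_deriv hs
  have cφ := hs.continuous
  have cψ := (contDiff_one_deriv hs).continuous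
  have ρ0 := P.pos
  have c0 := P.c_pos
  have hint := integrable_energy_density hs hcs
  induction n with
  | zero =>
    intro x₀ hz _ _
    have hz' : ∀ x, x₀ < x → φ x = 0 := fun x hx => hz x (by simpa using hx.le)
    have h1 := deriv_eq_zero_of_eq_zero_beyond hz'
    have h2 := deriv_eq_zero_of_eq_zero_beyond h1
    have hx₀ : φ x₀ = 0 := hz x₀ (by simp)
    rw [setIntegral_eq_zero_of_forall_eq_zero fun x hx => by simp [hx₀, h1 x hx, h2 x hx], hx₀]
    simp
  | succ n ih =>
    intro x₀ hz hcrit hmax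
    set m := φ x₀ with hm
    rcases (hpos x₀).eq_or_lt with hm0 | hm0
    · have hz' : ∀ x, x₀ < x → φ x = 0 := fun x hx =>
        le_antisymm ((hmax x hx.le).trans (le_of_eq (hm.trans hm0.symm))) (hpos x)
      have h1 := deriv_eq_zero_of_eq_zero_beyond hz'
      have h2 := deriv_eq_zero_of_eq_zero_beyond h1
      have hx₀ : m = 0 := hm.trans hm0.symm
      rw [setIntegral_eq_zero_of_forall_eq_zero fun x hx => by simp [hx₀, h1 x hx, h2 x hx], hx₀]
      simp
    rw [← hm] at hm0
    set b := x₀ + (n + 1 : ℕ) * ρ + 1 with hb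
    have hbx : x₀ + ρ < b := by
      rw [hb]; push_cast
      have : (0 : ℝ) ≤ n * ρ := by positivity
      linarith
    have hzb : ∀ x, x₀ + (n + 1 : ℕ) * ρ < x → φ x = 0 := fun x hx => hz x hx.le
    have h1b := deriv_eq_zero_of_eq_zero_beyond hzb
    have h2b := deriv_eq_zero_of_eq_zero_beyond h1b
    have hb' : x₀ + (n + 1 : ℕ) * ρ < b := by rw [hb]; linarith
    set e : ℝ → ℝ := fun x => deriv (deriv φ) x ^ 2 - deriv φ x ^ 2 + 2 * c * m * φ x with he
    have ie : ∀ a, IntegrableOn e (Ioi a) := fun a => (hint _).integrableOn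
    rcases le_or_gt (deriv φ (x₀ + ρ)) 0 with hsl | hsl
    · -- the function does not increase at `x₀ + ρ`
      have htail : ∫ x in Ioi b, e x = 0 := setIntegral_eq_zero_of_forall_eq_zero fun x hx => by
        have hx' := hb'.trans hx
        simp [he, hzb x hx', h1b x hx', h2b x hx']
      have hsplit : ∫ x in Ioi x₀, e x
          = (∫ x in x₀..x₀ + ρ, e x) + ∫ x in x₀ + ρ..b, e x := by
        rw [← intervalIntegral.integral_interval_add_Ioi (ie x₀) (ie (x₀ + ρ)),
          ← intervalIntegral.integral_interval_add_Ioi (ie (x₀ + ρ)) (ie b), htail, add_zero]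
      have hinit := initial_energy_ge P (φ := fun x => φ (x₀ + x))
        (ψ := fun x => deriv φ (x₀ + x)) (χ := fun x => deriv (deriv φ) (x₀ + x))
        (by fun_prop) (by fun_prop)
        (fun x _ => ((dφ (x₀ + x)).comp_const_add x₀ x).hasDerivWithinAt)
        (fun x _ => ((dψ (x₀ + x)).comp_const_add x₀ x).hasDerivWithinAt)
        (by
          obtain ⟨C, hC⟩ := isCompact_Icc.exists_bound_of_continuousOn
            ((by fun_prop : Continuous fun x => deriv (deriv φ) (x₀ + x)).continuousOn
              (s := Icc 0 ρ))
          exact MemLp.of_bound (by fun_prop : Continuous fun x =>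
            deriv (deriv φ) (x₀ + x)).aestronglyMeasurable C
            ((ae_restrict_iff' measurableSet_Ioc).2
            (Filter.Eventually.of_forall fun x hx => hC x (Ioc_subset_Icc_self hx))))
        (by simpa using hcrit)
      simp only [add_zero] at hinit
      rw [intervalIntegral.integral_comp_add_left
        (fun x => deriv (deriv φ) x ^ 2 - deriv φ x ^ 2 + 2 * c * φ x₀ * φ x), add_zero,
        ← hm] at hinit
      rw [hsplit]
      set p := φ (x₀ + ρ)
      obtain ⟨s, hs'⟩ : ∃ s, deriv φ (x₀ + ρ) = -s := ⟨-deriv φ (x₀ + ρ), by ring⟩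
      have hs0 : 0 ≤ s := by linarith
      have hbound : ∀ k ∈ Ioo 0 (m / 10), c ^ 2 * ρ ^ 3 / 3 * m ^ 2
          - k * (0.33 * s + 0.162 * p + 0.081 * k) - 9 / 100 * k ^ 2 * (b - (x₀ + ρ))
          ≤ (∫ x in x₀..x₀ + ρ, e x) + ∫ x in x₀ + ρ..b, e x := by
        intro k hk
        have hcal := calibrated_energy_ge P dφ dψ cχ hbx.le (fun x _ => hpos x)
          (fun x hx => hmax x (by linarith [hx.1])) hk.1 hk.2.le
        have hmatch := matching_inequality P (m := m) (hpos (x₀ + ρ))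
          (hmax _ (by linarith)) hs0 hk.1
        rw [hzb b hb', h1b b hb', hs'] at hcal
        rw [hs'] at hinit
        simp only [mul_zero, zero_add, ne_eq, OfNat.ofNat_ne_zero, not_false_eq_true, zero_pow,
          zero_div, sub_zero] at hcal
        have := add_le_add hinit hcal
        refine le_trans ?_ this
        linarith
      have hlim : Filter.Tendsto (fun k : ℝ => c ^ 2 * ρ ^ 3 / 3 * m ^ 2
          - k * (0.33 * s + 0.162 * p + 0.081 * k) - 9 / 100 * k ^ 2 * (b - (x₀ + ρ)))
          (nhdsWithin 0 (Ioi 0)) (nhds (c ^ 2 * ρ ^ 3 / 3 * m ^ 2)) := by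
        have : Continuous fun k : ℝ => c ^ 2 * ρ ^ 3 / 3 * m ^ 2
          - k * (0.33 * s + 0.162 * p + 0.081 * k) - 9 / 100 * k ^ 2 * (b - (x₀ + ρ)) := by
          fun_prop
        simpa using (this.tendsto 0).mono_left nhdsWithin_le_nhds
      refine le_of_tendsto hlim ?_
      filter_upwards [Ioo_mem_nhdsGT (show (0 : ℝ) < m / 10 by positivity)] with k hk
      exact hbound k hk
    · -- the function increases at `x₀ + ρ`: pass to the minimum before and the maximum after it
      obtain ⟨y, hy, hymin⟩ := isCompact_Icc.exists_isMinOn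
        (nonempty_Icc.2 (by linarith : x₀ ≤ x₀ + ρ)) cφ.continuousOn
      have hyρ : y < x₀ + ρ := by
        refine lt_of_le_of_ne hy.2 fun h => ?_
        subst h
        exact absurd (hasDerivAt_nonpos_of_le_left (dφ _) (by linarith : x₀ < x₀ + ρ)
          fun z hz => hymin hz) (not_le.2 hsl)
      have hψy : deriv φ y = 0 := by
        rcases hy.1.eq_or_lt with h | h
        · rw [← h]; exact hcrit
        · exact (hymin.isLocalMin (Icc_mem_nhds h hyρ)).deriv_eq_zero
      obtain ⟨z, hz1, hzmax⟩ := isCompact_Icc.exists_isMaxOn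
        (nonempty_Icc.2 hbx.le) cφ.continuousOn
      have hzρ : x₀ + ρ < z := by
        refine lt_of_le_of_ne hz1.1 fun h => ?_
        subst h
        exact absurd (hasDerivAt_nonpos_of_le_right (dφ _) hbx fun y hy => hzmax hy)
          (not_le.2 hsl)
      have hzb1 : z < b := by
        refine lt_of_le_of_ne hz1.2 fun h => ?_
        have h1 : φ (x₀ + ρ) ≤ φ z := hzmax ⟨le_rfl, hbx.le⟩
        rw [h, hzb b hb'] at h1
        exact absurd (hasDerivAt_nonpos_of_le_left (dφ _) (by linarith : x₀ < x₀ + ρ)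
          fun z _ => h1.trans (hpos z)) (not_le.2 hsl)
      have hψz : deriv φ z = 0 :=
        (hzmax.isLocalMax (Icc_mem_nhds hzρ hzb1)).deriv_eq_zero
      have hzglob : ∀ x, z ≤ x → φ x ≤ φ z := by
        intro x hx
        rcases le_or_gt x b with h | h
        · exact hzmax ⟨by linarith, h⟩
        · rw [hzb x (by linarith)]; exact hpos z
      have hrec := ih z (fun x hx => hz x (by push_cast; linarith)) hψz hzglob
      have hzm : φ z ≤ m := hmax z (by linarith)
      have hlz : φ y ≤ φ z := (hymin ⟨by linarith, le_rfl⟩ : φ y ≤ φ (x₀ + ρ)).trans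
        (hzmax ⟨le_rfl, hbx.le⟩)
      have hrec' : c ^ 2 * ρ ^ 3 / 3 * φ y ^ 2 ≤ ∫ x in Ioi z, e x := by
        have h1 : c ^ 2 * ρ ^ 3 / 3 * φ y ^ 2 ≤ c ^ 2 * ρ ^ 3 / 3 * φ z ^ 2 := by
          have := hpos y
          gcongr
        refine h1.trans (hrec.trans ?_)
        refine setIntegral_mono (hint _).integrableOn (ie z) fun x => ?_
        have := hpos x
        simp only [he]
        gcongr
      have hmid := energy_between_critical_nonneg P dφ dψ cχ (by linarith : y ≤ z)
        (fun x _ => hpos x) (fun x hx => hmax x (by linarith [hx.1, hy.1])) hm0 hψy hψz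
      have hdesc := descent_energy_ge P (φ := fun x => φ (x₀ + x))
        (ψ := fun x => deriv φ (x₀ + x)) (χ := fun x => deriv (deriv φ) (x₀ + x))
        (fun x => (dφ (x₀ + x)).comp_const_add x₀ x)
        (fun x => (dψ (x₀ + x)).comp_const_add x₀ x) (by fun_prop) (Y := y - x₀)
        (by linarith [hy.1]) (by linarith) (by simpa using hcrit) (by simpa using hψy)
        (by simpa using hpos y) (fun x hx => by
          simp only [add_sub_cancel]
          exact hymin ⟨by linarith [hx.1], by linarith [hx.2]⟩)
      simp only [add_zero, add_sub_cancel] at hdesc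
      rw [intervalIntegral.integral_comp_add_left
        (fun x => deriv (deriv φ) x ^ 2 - deriv φ x ^ 2 + 2 * c * φ x₀ * φ x), add_zero,
        add_sub_cancel, ← hm] at hdesc
      rw [← intervalIntegral.integral_interval_add_Ioi (ie x₀) (ie y),
        ← intervalIntegral.integral_interval_add_Ioi (ie y) (ie z)]
      linarith

theorem half_line_energy_ge {ρ w c : ℝ} (P : ProfileConstants ρ w c) {φ : ℝ → ℝ}
    (hs : ContDiff ℝ 2 φ) (hcs : HasCompactSupport φ) (hpos : ∀ x, 0 ≤ φ x) {x₀ : ℝ}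
    (hcrit : deriv φ x₀ = 0) (hmax : ∀ x, φ x ≤ φ x₀) :
    c ^ 2 * ρ ^ 3 / 3 * φ x₀ ^ 2
      ≤ ∫ x in Ioi x₀, (deriv (deriv φ) x ^ 2 - deriv φ x ^ 2 + 2 * c * φ x₀ * φ x) := by
  obtain ⟨R, hR⟩ := hcs.isCompact.isBounded.subset_closedBall 0
  obtain ⟨n, hn⟩ := exists_nat_gt ((R - x₀) / ρ)
  rw [div_lt_iff₀ P.pos] at hn
  refine half_line_energy_ge_aux P hs hcs hpos n x₀ (fun x hx => ?_) hcrit fun x _ => hmax x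
  refine image_eq_zero_of_notMem_tsupport fun h => ?_
  have := hR h
  rw [mem_closedBall_zero_iff, Real.norm_eq_abs] at this
  linarith [le_abs_self x]

/-! ### The sharp interpolation inequality -/

/-- The sharp interpolation inequality for nonnegative smooth functions of compact support: the
half-line bounds on both sides of the maximum `m` are added, and `m` is eliminated by completing the
square in `2 c m ∫ φ`. -/
theorem integral_deriv_sq_le {ρ w c : ℝ} (P : ProfileConstants ρ w c) {φ : ℝ → ℝ}
    (hs : ContDiff ℝ 2 φ) (hcs : HasCompactSupport φ) (hpos : ∀ x, 0 ≤ φ x) :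
    ∫ x, deriv φ x ^ 2 ≤ (∫ x, deriv (deriv φ) x ^ 2) + 3 / (2 * ρ ^ 3) * (∫ x, φ x) ^ 2 := by
  obtain ⟨x₀, hmax⟩ := hs.continuous.exists_forall_ge_of_hasCompactSupport hcs
  have hcrit : deriv φ x₀ = 0 :=
    IsLocalMax.deriv_eq_zero (Filter.Eventually.of_forall hmax)
  have hR := half_line_energy_ge P hs hcs hpos hcrit hmax
  have d1 : deriv (fun x => φ (-x)) = fun x => -deriv φ (-x) := by
    ext x; rw [deriv_comp_neg]
  have d2 : deriv (deriv fun x => φ (-x)) = fun x => deriv (deriv φ) (-x) := by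
    ext x; rw [d1, deriv.fun_neg, deriv_comp_neg]; simp
  have hL := half_line_energy_ge P (φ := fun x => φ (-x)) (x₀ := -x₀) (hs.comp contDiff_neg)
    (hcs.comp_homeomorph (Homeomorph.neg ℝ)) (fun x => hpos _)
    (by simp [d1, hcrit]) (fun x => by simpa using hmax (-x))
  rw [d2, d1] at hL
  simp only [neg_sq, neg_neg] at hL
  rw [integral_comp_neg_Ioi (-x₀)
    (fun x => deriv (deriv φ) x ^ 2 - deriv φ x ^ 2 + 2 * c * φ x₀ * φ x), neg_neg] at hL
  have hint := integrable_energy_density hs hcs (2 * c * φ x₀)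
  have hsum := intervalIntegral.integral_Iic_add_Ioi hint.integrableOn hint.integrableOn (b := x₀)
  have i1 := integrable_deriv_deriv_sq hs hcs
  have i2 := integrable_deriv_sq hs hcs
  have i3 := hs.continuous.integrable_of_hasCompactSupport (μ := volume) hcs
  have i12 : Integrable fun x => deriv (deriv φ) x ^ 2 - deriv φ x ^ 2 := i1.sub i2
  rw [integral_add i12 (i3.const_mul _), integral_sub i1 i2, integral_const_mul] at hsum
  have hρ := P.pos
  have hsq : 2 * c * φ x₀ * (∫ x, φ x)
      ≤ 3 / (2 * ρ ^ 3) * (∫ x, φ x) ^ 2 + 2 * (c ^ 2 * ρ ^ 3 / 3 * φ x₀ ^ 2) := by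
    have h1 : 0 ≤ 3 / (2 * ρ ^ 3) * ((∫ x, φ x) - 2 * ρ ^ 3 / 3 * c * φ x₀) ^ 2 := by positivity
    have h2 : 3 / (2 * ρ ^ 3) * ((∫ x, φ x) - 2 * ρ ^ 3 / 3 * c * φ x₀) ^ 2
        = 3 / (2 * ρ ^ 3) * (∫ x, φ x) ^ 2 + 2 * (c ^ 2 * ρ ^ 3 / 3 * φ x₀ ^ 2)
          - 2 * c * φ x₀ * (∫ x, φ x) := by
      field_simp
      ring
    linarith
  linarith

/-- The interpolation inequality applied to the dilations of `φ`. -/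
theorem integral_deriv_sq_le_scaled {ρ w c : ℝ} (P : ProfileConstants ρ w c) {φ : ℝ → ℝ}
    (hs : ContDiff ℝ 2 φ) (hcs : HasCompactSupport φ) (hpos : ∀ x, 0 ≤ φ x) {l : ℝ} (hl : 0 < l) :
    l ^ 2 * ∫ x, deriv φ x ^ 2
      ≤ (∫ x, deriv (deriv φ) x ^ 2) + 3 / (2 * ρ ^ 3) * l ^ 5 * (∫ x, φ x) ^ 2 := by
  have hli : l⁻¹ ≠ 0 := inv_ne_zero hl.ne'
  have d1 : deriv (fun x => φ (l⁻¹ * x)) = fun x => l⁻¹ * deriv φ (l⁻¹ * x) := by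
    ext x; simpa using deriv_comp_mul_left l⁻¹ φ x
  have d2 : deriv (deriv fun x => φ (l⁻¹ * x)) = fun x => l⁻¹ ^ 2 * deriv (deriv φ) (l⁻¹ * x) := by
    ext x
    rw [d1, deriv_const_mul_field, deriv_comp_mul_left, smul_eq_mul]
    ring
  have h := integral_deriv_sq_le P (φ := fun x => φ (l⁻¹ * x)) (by fun_prop)
    (hcs.comp_homeomorph (Homeomorph.mulLeft₀ l⁻¹ hli)) (fun x => hpos _)
  rw [d2, d1] at h
  simp only [mul_pow] at h
  rw [integral_const_mul, integral_const_mul,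
    Measure.integral_comp_mul_left (fun x => deriv φ x ^ 2),
    Measure.integral_comp_mul_left (fun x => deriv (deriv φ) x ^ 2),
    Measure.integral_comp_mul_left φ, inv_inv, abs_of_pos hl] at h
  simp only [smul_eq_mul] at h
  have h' := mul_le_mul_of_nonneg_left h (by positivity : 0 ≤ l ^ 3)
  have hρ := P.pos
  refine (le_of_eq ?_).trans (h'.trans (le_of_eq ?_)) <;> field_simp

/-! ### Weak derivatives -/

theorem HasWeakDeriv.ae_eq {f g f' g' : ℝ → ℝ} (h : HasWeakDeriv f g) (h' : HasWeakDeriv f' g')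
    (hf : f =ᵐ[volume] f') : g =ᵐ[volume] g' := by
  refine ae_eq_of_integral_contDiff_smul_eq h.2.1 h'.2.1 fun ψ hψ hc => ?_
  have e1 := h.2.2 ψ hψ hc
  have e2 := h'.2.2 ψ hψ hc
  have e3 : ∫ x, f x * deriv ψ x = ∫ x, f' x * deriv ψ x :=
    integral_congr_ae (hf.mono fun x hx => by simp only [hx])
  have e4 : ∀ k : ℝ → ℝ, ∫ x, ψ x • k x = ∫ x, k x * ψ x := fun k =>
    integral_congr_ae (Filter.Eventually.of_forall fun x => by simp [mul_comm])
  rw [e4, e4]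
  linarith

theorem HasWeakDeriv.congr {f f' g : ℝ → ℝ} (h : HasWeakDeriv f g) (hf : f =ᵐ[volume] f') :
    HasWeakDeriv f' g := by
  refine ⟨h.1.congr hf, h.2.1, fun ψ hψ hc => ?_⟩
  rw [← h.2.2 ψ hψ hc]
  exact integral_congr_ae (hf.mono fun x hx => by simp only [hx])

theorem HasWeakDeriv.weakDeriv_ae_eq {f g : ℝ → ℝ} (h : HasWeakDeriv f g) :
    weakDeriv f =ᵐ[volume] g := by
  have hex : ∃ g, HasWeakDeriv f g := ⟨g, h⟩
  rw [weakDeriv, dif_pos hex]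
  exact hex.choose_spec.ae_eq h (Filter.EventuallyEq.refl _ _)

theorem HasWeakDeriv.weakDeriv_weakDeriv_ae_eq {f g k : ℝ → ℝ} (h : HasWeakDeriv f g)
    (hk : HasWeakDeriv g k) : weakDeriv (weakDeriv f) =ᵐ[volume] k :=
  (hk.congr h.weakDeriv_ae_eq.symm).weakDeriv_ae_eq

theorem bendingEnergy_eq {f g k : ℝ → ℝ} (h : HasWeakDeriv f g) (hk : HasWeakDeriv g k) :
    bendingEnergy f = ∫ x, k x ^ 2 :=
  integral_congr_ae ((h.weakDeriv_weakDeriv_ae_eq hk).mono fun x hx => by simp only [hx])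

theorem excessLength_eq {f g : ℝ → ℝ} (h : HasWeakDeriv f g) (hg : MemLp g 2) (hf : Integrable f) :
    excessLength f = (∫ x, g x ^ 2) / 2 - ∫ x, f x := by
  have : excessLength f = ∫ x, (g x ^ 2 / 2 - f x) :=
    integral_congr_ae (h.weakDeriv_ae_eq.mono fun x hx => by simp only [hx])
  rw [this, integral_sub (hg.integrable_sq.div_const 2) hf, integral_div]

theorem hasWeakDeriv_of_hasDerivAt {f f' : ℝ → ℝ} (hf : ∀ x, HasDerivAt f (f' x) x)
    (hf' : Continuous f') : HasWeakDeriv f f' := by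
  have cf : Continuous f := continuous_iff_continuousAt.2 fun x => (hf x).continuousAt
  refine ⟨cf.locallyIntegrable, hf'.locallyIntegrable, fun ψ hψ hc => ?_⟩
  have cψ := hψ.continuous
  have cψ' : Continuous (deriv ψ) := hψ.continuous_deriv (by simp)
  refine integral_mul_deriv_eq_deriv_mul_of_integrable (fun x _ => hf x)
    (fun x _ => ((hψ.differentiable (by simp)) x).hasDerivAt) ?_ ?_ ?_
  · exact (cf.mul cψ').integrable_of_hasCompactSupport hc.deriv.mul_left
  · exact (hf'.mul cψ).integrable_of_hasCompactSupport hc.mul_left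
  · exact (cf.mul cψ).integrable_of_hasCompactSupport hc.mul_left

/-! ### Mollification -/

section Mollification

open scoped Convolution

variable (η : ContDiffBump (0 : ℝ)) {f g : ℝ → ℝ}

/-- The mollification of `f` by the normalised bump function `η`. -/
noncomputable def mollify (η : ContDiffBump (0 : ℝ)) (f : ℝ → ℝ) : ℝ → ℝ :=
  η.normed volume ⋆[ContinuousLinearMap.lsmul ℝ ℝ, volume] f

lemma mollify_apply (x : ℝ) : mollify η f x = ∫ t, η.normed volume t * f (x - t) := rfl

lemma contDiff_mollify (hf : LocallyIntegrable f) : ContDiff ℝ ∞ (mollify η f) :=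
  η.hasCompactSupport_normed.contDiff_convolution_left _ η.contDiff_normed hf

lemma hasDerivAt_mollify (h : HasWeakDeriv f g) (x : ℝ) :
    HasDerivAt (mollify η f) (mollify η g x) x := by
  have hη : ContDiff ℝ ∞ (η.normed volume) := η.contDiff_normed
  have h1 := η.hasCompactSupport_normed.hasDerivAt_convolution_left (μ := volume)
    (ContinuousLinearMap.lsmul ℝ ℝ) (hη.of_le (by simp)) h.1 x
  refine h1.congr_deriv ?_
  have h2 := h.2.2 (fun t => η.normed volume (x - t)) (hη.comp (by fun_prop))
    (η.hasCompactSupport_normed.comp_homeomorph (Homeomorph.subLeft x))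
  have h3 : deriv (fun t => η.normed volume (x - t)) = fun t => -deriv (η.normed volume) (x - t) := by
    ext t; exact deriv_comp_const_sub (f := η.normed volume) x t
  rw [h3] at h2
  rw [mollify, convolution_eq_swap, convolution_eq_swap]
  simp only [ContinuousLinearMap.lsmul_apply, smul_eq_mul]
  have e1 : ∫ t, deriv (η.normed volume) (x - t) * f t
      = -∫ t, f t * -deriv (η.normed volume) (x - t) := by
    rw [← integral_neg]; congr 1; ext t; ring
  rw [e1, h2, neg_neg]
  congr 1; ext t; ring

lemma integrable_mollify (hf : Integrable f) : Integrable (mollify η f) :=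
  η.integrable_normed.integrable_convolution _ hf

lemma integral_mollify (hf : Integrable f) : ∫ x, mollify η f x = ∫ x, f x := by
  have := integral_convolution (ContinuousLinearMap.lsmul ℝ ℝ) (μ := volume) (ν := volume)
    (η.integrable_normed (μ := volume)) hf
  rw [mollify, this, η.integral_normed]
  simp

lemma mollify_nonneg (hf : ∀ᵐ x, 0 ≤ f x) (x : ℝ) : 0 ≤ mollify η f x := by
  rw [mollify, convolution_eq_swap]
  refine integral_nonneg_of_ae (hf.mono fun t ht => ?_)
  exact mul_nonneg (η.nonneg_normed _) ht

/-- Jensen's inequality for the average `mollify η f x`. -/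
lemma mollify_sq_le (hf : LocallyIntegrable f) (hf2 : LocallyIntegrable fun x => f x ^ 2) (x : ℝ) :
    mollify η f x ^ 2 ≤ mollify η (fun y => f y ^ 2) x := by
  have i0 : Integrable (η.normed volume) (volume : Measure ℝ) := η.integrable_normed
  have hη : Continuous (η.normed (volume : Measure ℝ)) := η.continuous_normed
  have i1 : Integrable fun t => η.normed volume t * f (x - t) :=
    η.hasCompactSupport_normed.convolutionExists_left (ContinuousLinearMap.lsmul ℝ ℝ) hη hf x
  have i2 : Integrable fun t => η.normed volume t * f (x - t) ^ 2 :=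
    η.hasCompactSupport_normed.convolutionExists_left (ContinuousLinearMap.lsmul ℝ ℝ) hη hf2 x
  set a := mollify η f x with ha
  have h1 : 0 ≤ ∫ t, η.normed volume t * (f (x - t) - a) ^ 2 :=
    integral_nonneg fun t => mul_nonneg (η.nonneg_normed _) (sq_nonneg _)
  have h2 : ∫ t, η.normed volume t * (f (x - t) - a) ^ 2
      = mollify η (fun y => f y ^ 2) x - 2 * a * a + a ^ 2 := by
    have : ∀ t, η.normed volume t * (f (x - t) - a) ^ 2
        = η.normed volume t * f (x - t) ^ 2 - 2 * a * (η.normed volume t * f (x - t))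
          + a ^ 2 * η.normed volume t := fun t => by ring
    simp_rw [this]
    have i3 : Integrable fun t => η.normed volume t * f (x - t) ^ 2
        - 2 * a * (η.normed volume t * f (x - t)) := i2.sub (i1.const_mul _)
    rw [integral_add i3 (i0.const_mul _), integral_sub i2 (i1.const_mul _), integral_const_mul,
      integral_const_mul, η.integral_normed, mollify_apply η (f := fun y => f y ^ 2), mul_one,
      ← mollify_apply, ← ha]
  linarith

lemma memLp_mollify (hf : MemLp f 2) : MemLp (mollify η f) 2 := by
  have hl : LocallyIntegrable f := hf.locallyIntegrable (by norm_num)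
  have hc : Continuous (mollify η f) := (contDiff_mollify η hl).continuous
  rw [memLp_two_iff_integrable_sq hc.aestronglyMeasurable]
  refine (integrable_mollify η hf.integrable_sq).mono' (hc.pow 2).aestronglyMeasurable
    (Filter.Eventually.of_forall fun x => ?_)
  rw [Real.norm_of_nonneg (sq_nonneg _)]
  exact mollify_sq_le η hl hf.integrable_sq.locallyIntegrable x

lemma integral_mollify_sq_le (hf : MemLp f 2) : ∫ x, mollify η f x ^ 2 ≤ ∫ x, f x ^ 2 := by
  have hl : LocallyIntegrable f := hf.locallyIntegrable (by norm_num)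
  rw [← integral_mollify η hf.integrable_sq]
  exact integral_mono (memLp_mollify η hf).integrable_sq (integrable_mollify η hf.integrable_sq)
    fun x => mollify_sq_le η hl hf.integrable_sq.locallyIntegrable x

/-- The `L²` norm is not lost in the limit of mollifications, by Fatou's lemma. -/
lemma exists_mollify_sq_ge (hf : MemLp f 2) {ε : ℝ} (hε : 0 < ε) :
    ∃ η : ContDiffBump (0 : ℝ), (∫ x, f x ^ 2) - ε ≤ ∫ x, mollify η f x ^ 2 := by
  by_contra! hcon
  have hl : LocallyIntegrable f := hf.locallyIntegrable (by norm_num)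
  let η : ℕ → ContDiffBump (0 : ℝ) := fun n =>
    ⟨1 / ((n : ℝ) + 1), 2 * (1 / ((n : ℝ) + 1)), by positivity, by
      have : 0 < 1 / ((n : ℝ) + 1) := by positivity
      linarith⟩
  have hlim : ∀ᵐ x, Filter.Tendsto (fun n => mollify (η n) f x) Filter.atTop (nhds (f x)) := by
    refine ContDiffBump.ae_convolution_tendsto_right_of_locallyIntegrable (K := 2) ?_ ?_ hl
    · have := (tendsto_one_div_add_atTop_nhds_zero_nat (𝕜 := ℝ)).const_mul 2
      rwa [mul_zero] at this
    · exact Filter.Eventually.of_forall fun n => le_rfl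
  have hc : ∀ n, Continuous (mollify (η n) f) := fun n => (contDiff_mollify _ hl).continuous
  have hF : ∫⁻ x, Filter.liminf (fun n => ENNReal.ofReal (mollify (η n) f x ^ 2)) Filter.atTop
      ≤ Filter.liminf (fun n => ∫⁻ x, ENNReal.ofReal (mollify (η n) f x ^ 2)) Filter.atTop :=
    lintegral_liminf_le fun n => ((hc n).pow 2).measurable.ennreal_ofReal
  have e1 : ∫⁻ x, Filter.liminf (fun n => ENNReal.ofReal (mollify (η n) f x ^ 2)) Filter.atTop
      = ∫⁻ x, ENNReal.ofReal (f x ^ 2) := by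
    refine lintegral_congr_ae (hlim.mono fun x hx => ?_)
    exact (ENNReal.tendsto_ofReal (hx.pow 2)).liminf_eq
  have e2 : ∀ n, ∫⁻ x, ENNReal.ofReal (mollify (η n) f x ^ 2)
      ≤ ENNReal.ofReal ((∫ x, f x ^ 2) - ε) := fun n => by
    rw [← ofReal_integral_eq_lintegral_ofReal (memLp_mollify _ hf).integrable_sq
      (Filter.Eventually.of_forall fun x => sq_nonneg _)]
    exact ENNReal.ofReal_le_ofReal (hcon _).le
  rw [e1, ← ofReal_integral_eq_lintegral_ofReal hf.integrable_sq
    (Filter.Eventually.of_forall fun x => sq_nonneg _)] at hF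
  have h3 := hF.trans (Filter.liminf_le_of_frequently_le'
    (Filter.Frequently.of_forall e2))
  have h4 : 0 ≤ (∫ x, f x ^ 2) - ε :=
    (integral_nonneg fun x => sq_nonneg (mollify (η 0) f x)).trans (hcon (η 0)).le
  have := (ENNReal.ofReal_le_ofReal_iff h4).1 h3
  linarith

end Mollification

/-! ### Approximation by smooth functions of compact support -/

/-- Multiplication by a dilated bump function turns a smooth function in `W^{2,2} ∩ L¹` into a
function of compact support, with a small change of the three integrals. -/
theorem exists_cutoff_approx {f f' f'' : ℝ → ℝ} (hs : ContDiff ℝ ∞ f)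
    (hf : ∀ x, HasDerivAt f (f' x) x) (hf' : ∀ x, HasDerivAt f' (f'' x) x) (hc'' : Continuous f'')
    (h0 : MemLp f 2) (h1 : MemLp f' 2) (h2 : MemLp f'' 2) (hint : Integrable f)
    (hpos : ∀ x, 0 ≤ f x) {ε : ℝ} (hε : 0 < ε) :
    ∃ ψ : ℝ → ℝ, ContDiff ℝ ∞ ψ ∧ HasCompactSupport ψ ∧ (∀ x, 0 ≤ ψ x) ∧
      (∫ x, deriv (deriv ψ) x ^ 2) < (∫ x, f'' x ^ 2) + ε ∧ ∫ x, ψ x < (∫ x, f x) + ε ∧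
      (∫ x, f' x ^ 2) - ε < ∫ x, deriv ψ x ^ 2 := by
  have cf := hs.continuous
  have cf' : Continuous f' := continuous_iff_continuousAt.2 fun x => (hf' x).continuousAt
  let B : ContDiffBump (0 : ℝ) := ⟨1, 2, by norm_num, by norm_num⟩
  set b : ℝ → ℝ := fun x => B x with hb
  have sb : ContDiff ℝ ∞ b := B.contDiff
  have sb2 : ContDiff ℝ 2 b := contDiff_infty.1 sb 2
  have kb : HasCompactSupport b := B.hasCompactSupport
  have cb := sb.continuous
  have db := hasDerivAt_deriv_of_contDiff_two sb2
  have db' := hasDerivAt_deriv_deriv sb2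
  have cb' := (contDiff_one_deriv sb2).continuous
  have cb'' := continuous_deriv_deriv sb2
  have hb0 : b 0 = 1 := B.one_of_mem_closedBall (by simp [B])
  have hbnn : ∀ x, 0 ≤ b x := fun x => B.nonneg
  have hb1 : ∀ x, b x ≤ 1 := fun x => B.le_one
  obtain ⟨C₁, hC₁⟩ := kb.deriv.exists_bound_of_continuous cb'
  obtain ⟨C₂, hC₂⟩ := kb.deriv.deriv.exists_bound_of_continuous cb''
  simp only [Real.norm_eq_abs] at hC₁ hC₂
  set r : ℕ → ℝ := fun n => 1 / ((n : ℝ) + 1) with hr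
  have hr0 : ∀ n, 0 < r n := fun n => by simp only [hr]; positivity
  have hr1 : ∀ n, r n ≤ 1 := fun n => by
    simp only [hr]; rw [div_le_one (by positivity)]; linarith [(Nat.cast_nonneg n : (0 : ℝ) ≤ n)]
  have hrlim : Filter.Tendsto r Filter.atTop (nhds 0) := tendsto_one_div_add_atTop_nhds_zero_nat
  set F : ℕ → ℝ → ℝ := fun n x => b (r n * x) * f x with hF
  set F' : ℕ → ℝ → ℝ := fun n x => r n * deriv b (r n * x) * f x + b (r n * x) * f' x with hF'
  set F'' : ℕ → ℝ → ℝ := fun n x => r n ^ 2 * deriv (deriv b) (r n * x) * f x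
    + 2 * (r n * deriv b (r n * x) * f' x) + b (r n * x) * f'' x with hF''
  have dF : ∀ n x, HasDerivAt (F n) (F' n x) x := fun n x => by
    have e := (db (r n * x)).comp x ((hasDerivAt_id' x).const_mul (r n))
    refine (e.mul (hf x)).congr_deriv ?_
    simp only [hF', Function.comp]; ring
  have dF' : ∀ n x, HasDerivAt (F' n) (F'' n x) x := fun n x => by
    have e := (db (r n * x)).comp x ((hasDerivAt_id' x).const_mul (r n))
    have e' := (db' (r n * x)).comp x ((hasDerivAt_id' x).const_mul (r n))
    refine (((e'.const_mul (r n)).mul (hf x)).add (e.mul (hf' x))).congr_deriv ?_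
    simp only [hF'', Function.comp]; ring
  have eF : ∀ n, deriv (F n) = F' n := fun n => funext fun x => (dF n x).deriv
  have eF' : ∀ n, deriv (deriv (F n)) = F'' n := fun n => by
    rw [eF]; exact funext fun x => (dF' n x).deriv
  -- pointwise limits
  have hrx : ∀ x : ℝ, Filter.Tendsto (fun n => r n * x) Filter.atTop (nhds 0) := fun x => by
    simpa using hrlim.mul_const x
  have lb : ∀ x, Filter.Tendsto (fun n => b (r n * x)) Filter.atTop (nhds 1) := fun x => by
    rw [← hb0]; exact (cb.tendsto 0).comp (hrx x)
  have lb' : ∀ x, Filter.Tendsto (fun n => deriv b (r n * x)) Filter.atTop (nhds (deriv b 0)) :=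
    fun x => (cb'.tendsto 0).comp (hrx x)
  have lb'' : ∀ x, Filter.Tendsto (fun n => deriv (deriv b) (r n * x)) Filter.atTop
    (nhds (deriv (deriv b) 0)) := fun x => (cb''.tendsto 0).comp (hrx x)
  have l0 : ∀ x, Filter.Tendsto (fun n => F n x) Filter.atTop (nhds (f x)) := fun x => by
    simpa using (lb x).mul_const (f x)
  have l1 : ∀ x, Filter.Tendsto (fun n => F' n x) Filter.atTop (nhds (f' x)) := fun x => by
    simpa using ((hrlim.mul (lb' x)).mul_const (f x)).add ((lb x).mul_const (f' x))
  have l2 : ∀ x, Filter.Tendsto (fun n => F'' n x) Filter.atTop (nhds (f'' x)) := fun x => by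
    simpa using ((((hrlim.pow 2).mul (lb'' x)).mul_const (f x)).add
      (((hrlim.mul (lb' x)).mul_const (f' x)).const_mul 2)).add ((lb x).mul_const (f'' x))
  -- dominated convergence
  have bd0 : ∀ n x, |b (r n * x)| ≤ 1 := fun n x => by
    rw [abs_of_nonneg (hbnn _)]; exact hb1 _
  have bd1 : ∀ n x, |r n * deriv b (r n * x)| ≤ C₁ := fun n x => by
    rw [abs_mul, abs_of_pos (hr0 n)]
    exact (mul_le_of_le_one_left (abs_nonneg _) (hr1 n)).trans (hC₁ _)
  have bd2 : ∀ n x, |r n ^ 2 * deriv (deriv b) (r n * x)| ≤ C₂ := fun n x => by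
    rw [abs_mul, abs_of_pos (pow_pos (hr0 n) 2)]
    exact (mul_le_of_le_one_left (abs_nonneg _) (pow_le_one₀ (hr0 n).le (hr1 n))).trans (hC₂ _)
  have t0 : Filter.Tendsto (fun n => ∫ x, F n x) Filter.atTop (nhds (∫ x, f x)) := by
    refine tendsto_integral_of_dominated_convergence (fun x => |f x|)
      (fun n => (by fun_prop : Continuous (F n)).aestronglyMeasurable) hint.abs
      (fun n => Filter.Eventually.of_forall fun x => ?_)
      (Filter.Eventually.of_forall l0)
    rw [Real.norm_eq_abs, abs_mul]
    exact mul_le_of_le_one_left (abs_nonneg _) (bd0 n x)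
  have t1 : Filter.Tendsto (fun n => ∫ x, F' n x ^ 2) Filter.atTop (nhds (∫ x, f' x ^ 2)) := by
    refine tendsto_integral_of_dominated_convergence
      (fun x => 2 * (C₁ ^ 2 * f x ^ 2) + 2 * f' x ^ 2)
      (fun n => (by fun_prop : Continuous fun x => F' n x ^ 2).aestronglyMeasurable)
      (((h0.integrable_sq.const_mul _).const_mul 2).add (h1.integrable_sq.const_mul 2))
      (fun n => Filter.Eventually.of_forall fun x => ?_)
      (Filter.Eventually.of_forall fun x => (l1 x).pow 2)
    rw [Real.norm_of_nonneg (sq_nonneg _)]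
    have e0 : b (r n * x) ^ 2 ≤ 1 ^ 2 := sq_le_sq' (abs_le.1 (bd0 n x)).1 (abs_le.1 (bd0 n x)).2
    have e1 : (r n * deriv b (r n * x)) ^ 2 ≤ C₁ ^ 2 :=
      sq_le_sq' (abs_le.1 (bd1 n x)).1 (abs_le.1 (bd1 n x)).2
    calc F' n x ^ 2 ≤ 2 * ((r n * deriv b (r n * x)) ^ 2 * f x ^ 2)
          + 2 * (b (r n * x) ^ 2 * f' x ^ 2) := by
            simp only [hF']
            nlinarith [sq_nonneg (r n * deriv b (r n * x) * f x - b (r n * x) * f' x)]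
      _ ≤ 2 * (C₁ ^ 2 * f x ^ 2) + 2 * (1 ^ 2 * f' x ^ 2) := by gcongr
      _ = _ := by ring
  have t2 : Filter.Tendsto (fun n => ∫ x, F'' n x ^ 2) Filter.atTop (nhds (∫ x, f'' x ^ 2)) := by
    refine tendsto_integral_of_dominated_convergence
      (fun x => 3 * (C₂ ^ 2 * f x ^ 2) + 12 * (C₁ ^ 2 * f' x ^ 2) + 3 * f'' x ^ 2)
      (fun n => (by fun_prop : Continuous fun x => F'' n x ^ 2).aestronglyMeasurable)
      ((((h0.integrable_sq.const_mul _).const_mul 3).add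
        ((h1.integrable_sq.const_mul _).const_mul 12)).add (h2.integrable_sq.const_mul 3))
      (fun n => Filter.Eventually.of_forall fun x => ?_)
      (Filter.Eventually.of_forall fun x => (l2 x).pow 2)
    rw [Real.norm_of_nonneg (sq_nonneg _)]
    have e0 : b (r n * x) ^ 2 ≤ 1 ^ 2 := sq_le_sq' (abs_le.1 (bd0 n x)).1 (abs_le.1 (bd0 n x)).2
    have e1 : (r n * deriv b (r n * x)) ^ 2 ≤ C₁ ^ 2 :=
      sq_le_sq' (abs_le.1 (bd1 n x)).1 (abs_le.1 (bd1 n x)).2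
    have e2 : (r n ^ 2 * deriv (deriv b) (r n * x)) ^ 2 ≤ C₂ ^ 2 :=
      sq_le_sq' (abs_le.1 (bd2 n x)).1 (abs_le.1 (bd2 n x)).2
    have key : ∀ u v w : ℝ, (u + 2 * v + w) ^ 2 ≤ 3 * u ^ 2 + 12 * v ^ 2 + 3 * w ^ 2 :=
      fun u v w => by nlinarith [sq_nonneg (u - 2 * v), sq_nonneg (u - w), sq_nonneg (2 * v - w)]
    calc F'' n x ^ 2 ≤ 3 * ((r n ^ 2 * deriv (deriv b) (r n * x)) ^ 2 * f x ^ 2)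
          + 12 * ((r n * deriv b (r n * x)) ^ 2 * f' x ^ 2)
          + 3 * (b (r n * x) ^ 2 * f'' x ^ 2) := by
            simp only [← mul_pow]; exact key _ _ _
      _ ≤ 3 * (C₂ ^ 2 * f x ^ 2) + 12 * (C₁ ^ 2 * f' x ^ 2) + 3 * (1 ^ 2 * f'' x ^ 2) := by gcongr
      _ = _ := by ring
  obtain ⟨n, n0, n1, n2⟩ := (((t0.eventually_lt_const (lt_add_of_pos_right _ hε)).and
    ((t1.eventually_const_lt (sub_lt_self _ hε)).and
    (t2.eventually_lt_const (lt_add_of_pos_right _ hε))))).exists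
  refine ⟨F n, ?_, ?_, fun x => mul_nonneg (hbnn _) (hpos x), ?_, n0, ?_⟩
  · exact (sb.comp (contDiff_const.mul contDiff_id)).mul hs
  · exact (kb.comp_homeomorph (Homeomorph.mulLeft₀ (r n) (hr0 n).ne')).mul_right
  · rw [eF' n]; exact n2
  · rw [eF n]; exact n1

/-- Nonnegative functions in `W^{2,2} ∩ L¹` are approximated by smooth ones of compact support, in
the sense that is needed for the energy and the excess length. -/
theorem exists_smooth_approx {f g h : ℝ → ℝ} (hfg : HasWeakDeriv f g) (hgh : HasWeakDeriv g h)
    (h0 : MemLp f 2) (h1 : MemLp g 2) (h2 : MemLp h 2) (hint : Integrable f)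
    (hpos : ∀ᵐ x, 0 ≤ f x) {ε : ℝ} (hε : 0 < ε) :
    ∃ ψ : ℝ → ℝ, ContDiff ℝ ∞ ψ ∧ HasCompactSupport ψ ∧ (∀ x, 0 ≤ ψ x) ∧
      (∫ x, deriv (deriv ψ) x ^ 2) < (∫ x, h x ^ 2) + ε ∧ ∫ x, ψ x < (∫ x, f x) + ε ∧
      (∫ x, g x ^ 2) - ε < ∫ x, deriv ψ x ^ 2 := by
  obtain ⟨η, hη⟩ := exists_mollify_sq_ge h1 (half_pos hε)
  obtain ⟨ψ, a1, a2, a3, a4, a5, a6⟩ := exists_cutoff_approx (contDiff_mollify η hfg.1)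
    (hasDerivAt_mollify η hfg) (hasDerivAt_mollify η hgh)
    (contDiff_mollify η hgh.2.1).continuous (memLp_mollify η h0) (memLp_mollify η h1)
    (memLp_mollify η h2) (integrable_mollify η hint) (mollify_nonneg η hpos) (half_pos hε)
  refine ⟨ψ, a1, a2, a3, ?_, ?_, ?_⟩
  · linarith [integral_mollify_sq_le η h2]
  · linarith [integral_mollify η hint]
  · linarith

/-! ### The lower bound for the energy -/

/-- The interpolation inequality in `W^{2,2} ∩ L¹`. -/
theorem integral_weakDeriv_sq_le_scaled {ρ w c : ℝ} (P : ProfileConstants ρ w c) {f g h : ℝ → ℝ}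
    (hfg : HasWeakDeriv f g) (hgh : HasWeakDeriv g h)
    (h0 : MemLp f 2) (h1 : MemLp g 2) (h2 : MemLp h 2) (hint : Integrable f)
    (hpos : ∀ᵐ x, 0 ≤ f x) {l : ℝ} (hl : 0 < l) :
    l ^ 2 * ∫ x, g x ^ 2 ≤ (∫ x, h x ^ 2) + 3 / (2 * ρ ^ 3) * l ^ 5 * (∫ x, f x) ^ 2 := by
  have hρ := P.pos
  have hB : 0 ≤ ∫ x, f x := integral_nonneg_of_ae hpos
  have hlimL : Filter.Tendsto (fun ε => l ^ 2 * ((∫ x, g x ^ 2) - ε)) (nhdsWithin 0 (Ioi 0))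
      (nhds (l ^ 2 * ∫ x, g x ^ 2)) := by
    have : Continuous fun ε : ℝ => l ^ 2 * ((∫ x, g x ^ 2) - ε) := by fun_prop
    simpa using (this.tendsto 0).mono_left nhdsWithin_le_nhds
  have hlimR : Filter.Tendsto (fun ε => (∫ x, h x ^ 2) + ε
      + 3 / (2 * ρ ^ 3) * l ^ 5 * ((∫ x, f x) + ε) ^ 2) (nhdsWithin 0 (Ioi 0))
      (nhds ((∫ x, h x ^ 2) + 3 / (2 * ρ ^ 3) * l ^ 5 * (∫ x, f x) ^ 2)) := by
    have : Continuous fun ε : ℝ => (∫ x, h x ^ 2) + ε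
      + 3 / (2 * ρ ^ 3) * l ^ 5 * ((∫ x, f x) + ε) ^ 2 := by fun_prop
    simpa using (this.tendsto 0).mono_left nhdsWithin_le_nhds
  refine le_of_tendsto_of_tendsto hlimL hlimR ?_
  filter_upwards [self_mem_nhdsWithin] with ε hε
  obtain ⟨ψ, a1, a2, a3, a4, a5, a6⟩ :=
    exists_smooth_approx hfg hgh h0 h1 h2 hint hpos (mem_Ioi.1 hε)
  have key := integral_deriv_sq_le_scaled P (contDiff_infty.1 a1 2) a2 a3 hl
  have hψ0 : 0 ≤ ∫ x, ψ x := integral_nonneg a3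
  calc l ^ 2 * ((∫ x, g x ^ 2) - ε) ≤ l ^ 2 * ∫ x, deriv ψ x ^ 2 := by gcongr
    _ ≤ _ := key
    _ ≤ _ := by gcongr

lemma rpow_one_third_pow_three {x : ℝ} (hx : 0 ≤ x) : (x ^ (1 / 3 : ℝ)) ^ 3 = x := by
  rw [← Real.rpow_natCast, ← Real.rpow_mul hx]; norm_num

/-- The lower bound `6^{1/3} ρ²`. The dilation factor is the optimal one for the given mass `B`, and
the remaining inequality `(1 + B)⁵ ≥ 5⁵ 4⁻⁴ B⁴` is the inequality of arithmetic and geometric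
means, with equality for `B = 4`. -/
theorem le_bendingEnergy {ρ w c : ℝ} (P : ProfileConstants ρ w c) {φ : ℝ → ℝ}
    (hφ : φ ∈ sobolevClass) : (6 : ℝ) ^ (1 / 3 : ℝ) * ρ ^ 2 ≤ bendingEnergy φ := by
  obtain ⟨⟨h0, g, h, hfg, hgh, h1, h2⟩, hint, hpos, hL⟩ := hφ
  rw [bendingEnergy_eq hfg hgh]
  rw [excessLength_eq hfg h1 hint] at hL
  have hρ := P.pos
  have key := fun {l : ℝ} (hl : 0 < l) =>
    integral_weakDeriv_sq_le_scaled P hfg hgh h0 h1 h2 hint hpos hl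
  have hB : 0 ≤ ∫ x, φ x := integral_nonneg_of_ae hpos
  have hA : ∫ x, g x ^ 2 = 2 + 2 * ∫ x, φ x := by linarith
  rw [hA] at key
  generalize ∫ x, φ x = B at *
  generalize ∫ x, h x ^ 2 = E at *
  obtain ⟨s, hs0, hs⟩ : ∃ s : ℝ, 0 < s ∧ (6 : ℝ) ^ (1 / 3 : ℝ) = s := ⟨_, by positivity, rfl⟩
  have hs3 : s ^ 3 = 6 := by rw [← hs]; exact rpow_one_third_pow_three (by norm_num)
  rw [hs]
  rcases hB.eq_or_lt with rfl | hB
  · have h1 := key hρ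
    have : s < 2 := lt_of_pow_lt_pow_left₀ 3 (by norm_num) (by rw [hs3]; norm_num)
    have : s * ρ ^ 2 ≤ 2 * ρ ^ 2 := by gcongr
    simp only [mul_zero, add_zero, ne_eq, OfNat.ofNat_ne_zero, not_false_eq_true, zero_pow] at h1
    linarith
  obtain ⟨t, ht0, ht⟩ : ∃ t : ℝ, 0 < t ∧ t ^ 3 = 16 * (1 + B) / (5 * B ^ 2) :=
    ⟨_, by positivity, rpow_one_third_pow_three (by positivity)⟩
  have h1 := key (l := ρ / s * t) (by positivity)
  have e1 : 3 / (2 * ρ ^ 3) * (ρ / s * t) ^ 5 * B ^ 2 = (ρ / s * t) ^ 2 * (4 / 5 * (1 + B)) := by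
    have : 3 / (2 * ρ ^ 3) * (ρ / s * t) ^ 5 * B ^ 2
        = (ρ / s * t) ^ 2 * (3 / 2 * t ^ 3 * B ^ 2 / s ^ 3) := by field_simp
    rw [this, ht, hs3]
    field_simp
    ring
  rw [e1] at h1
  have h2 : 5 ≤ t ^ 2 * (1 + B) := by
    refine le_of_pow_le_pow_left₀ (n := 3) (by norm_num) (by positivity) ?_
    have : (t ^ 2 * (1 + B)) ^ 3 = (t ^ 3) ^ 2 * (1 + B) ^ 3 := by ring
    rw [this, ht]
    have : (16 * (1 + B) / (5 * B ^ 2)) ^ 2 * (1 + B) ^ 3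
        = 256 * (1 + B) ^ 5 / (25 * B ^ 4) := by field_simp; ring
    rw [this, le_div_iff₀ (by positivity)]
    have : 0 ≤ (B - 4) ^ 2 * (256 * B ^ 3 + 203 * B ^ 2 + 88 * B + 16) := by positivity
    nlinarith
  calc s * ρ ^ 2 = s ^ 3 * ρ ^ 2 / s ^ 2 := by field_simp
    _ = 6 / 5 * (ρ / s) ^ 2 * 5 := by rw [hs3]; ring
    _ ≤ 6 / 5 * (ρ / s) ^ 2 * (t ^ 2 * (1 + B)) := by gcongr
    _ = (ρ / s * t) ^ 2 * (2 + 2 * B) - (ρ / s * t) ^ 2 * (4 / 5 * (1 + B)) := by ring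
    _ ≤ E := by linarith

/-! ### Smooth admissible functions -/

section

variable {φ : ℝ → ℝ}

lemma hasWeakDeriv_of_contDiff_two (hs : ContDiff ℝ 2 φ) :
    HasWeakDeriv φ (deriv φ) ∧ HasWeakDeriv (deriv φ) (deriv (deriv φ)) :=
  ⟨hasWeakDeriv_of_hasDerivAt (hasDerivAt_deriv_of_contDiff_two hs)
    (contDiff_one_deriv hs).continuous,
  hasWeakDeriv_of_hasDerivAt (hasDerivAt_deriv_deriv hs) (continuous_deriv_deriv hs)⟩

lemma memW22_of_contDiff_two (hs : ContDiff ℝ 2 φ) (hcs : HasCompactSupport φ) : MemW22 φ :=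
  ⟨hs.continuous.memLp_of_hasCompactSupport hcs, _, _, (hasWeakDeriv_of_contDiff_two hs).1,
    (hasWeakDeriv_of_contDiff_two hs).2,
    (contDiff_one_deriv hs).continuous.memLp_of_hasCompactSupport hcs.deriv,
    (continuous_deriv_deriv hs).memLp_of_hasCompactSupport hcs.deriv.deriv⟩

lemma bendingEnergy_of_contDiff_two (hs : ContDiff ℝ 2 φ) :
    bendingEnergy φ = ∫ x, deriv (deriv φ) x ^ 2 :=
  bendingEnergy_eq (hasWeakDeriv_of_contDiff_two hs).1 (hasWeakDeriv_of_contDiff_two hs).2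

lemma excessLength_of_contDiff_two (hs : ContDiff ℝ 2 φ) (hcs : HasCompactSupport φ) :
    excessLength φ = (∫ x, deriv φ x ^ 2) / 2 - ∫ x, φ x :=
  excessLength_eq (hasWeakDeriv_of_contDiff_two hs).1
    ((contDiff_one_deriv hs).continuous.memLp_of_hasCompactSupport hcs.deriv)
    (hs.continuous.integrable_of_hasCompactSupport hcs)

end

theorem smoothClass_subset_sobolevClass : smoothClass ⊆ sobolevClass := by
  rintro φ ⟨hs, hcs, hpos, hL⟩
  have hs2 : ContDiff ℝ 2 φ := contDiff_infty.1 hs 2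
  exact ⟨memW22_of_contDiff_two hs2 hcs, hs.continuous.integrable_of_hasCompactSupport hcs,
    Filter.Eventually.of_forall hpos, hL⟩

/-- A smooth function of positive excess length becomes admissible by the dilation
`φ ↦ l² φ(x / l)`, which multiplies the excess length by `l³` and the energy by `l`. -/
theorem exists_mem_smoothClass_of_rescale {ψ : ℝ → ℝ} (hs : ContDiff ℝ ∞ ψ)
    (hcs : HasCompactSupport ψ) (hpos : ∀ x, 0 ≤ ψ x) {l : ℝ} (hl : 0 < l)
    (hL : l ^ 3 * ((∫ x, deriv ψ x ^ 2) / 2 - ∫ x, ψ x) = 1) :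
    ∃ φ ∈ smoothClass, bendingEnergy φ = l * ∫ x, deriv (deriv ψ) x ^ 2 := by
  have hli : l⁻¹ ≠ 0 := inv_ne_zero hl.ne'
  set φ : ℝ → ℝ := fun x => l ^ 2 * ψ (l⁻¹ * x) with hφ
  have sφ : ContDiff ℝ ∞ φ := contDiff_const.mul (hs.comp (contDiff_const.mul contDiff_id))
  have sφ2 : ContDiff ℝ 2 φ := contDiff_infty.1 sφ 2
  have kφ : HasCompactSupport φ :=
    (hcs.comp_homeomorph (Homeomorph.mulLeft₀ l⁻¹ hli)).mul_left (f := fun _ => l ^ 2)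
  have d1 : deriv φ = fun x => l * deriv ψ (l⁻¹ * x) := by
    ext x
    rw [hφ, deriv_const_mul_field, deriv_comp_mul_left, smul_eq_mul]
    field_simp
  have d2 : deriv (deriv φ) = fun x => deriv (deriv ψ) (l⁻¹ * x) := by
    ext x
    rw [d1, deriv_const_mul_field, deriv_comp_mul_left, smul_eq_mul]
    field_simp
  refine ⟨φ, ⟨sφ, kφ, fun x => mul_nonneg (by positivity) (hpos _), ?_⟩, ?_⟩
  · rw [excessLength_of_contDiff_two sφ2 kφ, d1, ← hL]
    simp only [mul_pow, hφ]
    rw [integral_const_mul, integral_const_mul,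
      Measure.integral_comp_mul_left (fun x => deriv ψ x ^ 2),
      Measure.integral_comp_mul_left ψ, inv_inv, abs_of_pos hl]
    simp only [smul_eq_mul]
    ring
  · rw [bendingEnergy_of_contDiff_two sφ2, d2,
      Measure.integral_comp_mul_left (fun x => deriv (deriv ψ) x ^ 2), inv_inv, abs_of_pos hl]
    rfl

/-- The energy of an admissible function is approximated from above by smooth admissible ones. -/
theorem exists_mem_smoothClass_bendingEnergy_lt {f : ℝ → ℝ} (hf : f ∈ sobolevClass) {ε : ℝ}
    (hε : 0 < ε) : ∃ φ ∈ smoothClass, bendingEnergy φ < bendingEnergy f + ε := by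
  obtain ⟨⟨h0, g, h, hfg, hgh, h1, h2⟩, hint, hpos, hL⟩ := hf
  rw [bendingEnergy_eq hfg hgh]
  rw [excessLength_eq hfg h1 hint] at hL
  have hE : 0 ≤ ∫ x, h x ^ 2 := integral_nonneg fun x => sq_nonneg _
  set E := ∫ x, h x ^ 2 with hEdef
  have hlim : Filter.Tendsto (fun δ : ℝ => (1 / (1 - 3 / 2 * δ)) ^ (1 / 3 : ℝ) * (E + δ))
      (nhdsWithin 0 (Ioi 0)) (nhds E) := by
    have : ContinuousAt (fun δ : ℝ => (1 / (1 - 3 / 2 * δ)) ^ (1 / 3 : ℝ) * (E + δ)) 0 := by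
      refine ContinuousAt.mul (ContinuousAt.rpow_const ?_ (Or.inl (by norm_num))) (by fun_prop)
      exact ContinuousAt.div (by fun_prop) (by fun_prop) (by norm_num)
    have := this.tendsto.mono_left (nhdsWithin_le_nhds (s := Ioi 0))
    simpa using this
  obtain ⟨δ, hδ1, hδ2⟩ := ((hlim.eventually_lt_const (lt_add_of_pos_right E hε)).and
    (Ioo_mem_nhdsGT (show (0 : ℝ) < 1 / 3 by norm_num))).exists
  obtain ⟨ψ, a1, a2, a3, a4, a5, a6⟩ :=
    exists_smooth_approx hfg hgh h0 h1 h2 hint hpos hδ2.1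
  set L := (∫ x, deriv ψ x ^ 2) / 2 - ∫ x, ψ x with hLdef
  have hL1 : 1 - 3 / 2 * δ < L := by linarith
  have hδ3 : 0 < 1 - 3 / 2 * δ := by linarith [hδ2.2]
  have hLpos : 0 < L := hδ3.trans hL1
  set l := (1 / L) ^ (1 / 3 : ℝ) with hl
  have hlpos : 0 < l := by positivity
  have hl3 : l ^ 3 * L = 1 := by
    rw [hl, rpow_one_third_pow_three (by positivity)]; field_simp
  obtain ⟨φ, hφ, hφE⟩ := exists_mem_smoothClass_of_rescale a1 a2 a3 hlpos hl3
  refine ⟨φ, hφ, ?_⟩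
  rw [hφE]
  refine lt_of_le_of_lt ?_ hδ1
  have : 0 ≤ E + δ := add_nonneg hE hδ2.1.le
  have hll : l ≤ (1 / (1 - 3 / 2 * δ)) ^ (1 / 3 : ℝ) := by
    rw [hl]
    exact Real.rpow_le_rpow (by positivity) (one_div_le_one_div_of_le hδ3 hL1.le) (by norm_num)
  calc l * ∫ x, deriv (deriv ψ) x ^ 2 ≤ l * (E + δ) := by gcongr
    _ ≤ _ := by gcongr

/-! ### Gluing at the ends of an interval -/

/-- The nearest point of `[-r, r]`. -/
noncomputable def clamp (r x : ℝ) : ℝ := max (-r) (min r x)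

lemma lipschitzWith_clamp (r : ℝ) : LipschitzWith 1 (clamp r) :=
  (LipschitzWith.id.const_min r).const_max (-r)

lemma clamp_of_abs_le {r x : ℝ} (h : |x| ≤ r) : clamp r x = x := by
  rw [clamp, min_eq_right (abs_le.1 h).2, max_eq_right (abs_le.1 h).1]

lemma clamp_of_le {r x : ℝ} (hr : 0 < r) (h : r ≤ x) : clamp r x = r := by
  rw [clamp, min_eq_left h, max_eq_right (by linarith)]

lemma clamp_of_le_neg {r x : ℝ} (hr : 0 < r) (h : x ≤ -r) : clamp r x = -r := by
  rw [clamp, min_eq_right (by linarith), max_eq_left h]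

/-- If `f = F'` vanishes at `±r`, then `F ∘ clamp r` has derivative `f ∘ clamp r`. -/
lemma hasDerivAt_comp_clamp {F f : ℝ → ℝ} {r : ℝ} (hr : 0 < r) (hF : ∀ x, HasDerivAt F (f x) x)
    (h1 : f r = 0) (h2 : f (-r) = 0) (x : ℝ) :
    HasDerivAt (fun y => F (clamp r y)) (f (clamp r x)) x := by
  rcases lt_or_ge |x| r with h | h
  · rw [clamp_of_abs_le h.le]
    refine (hF x).congr_of_eventuallyEq ?_
    filter_upwards [continuous_abs.continuousAt.eventually_lt continuousAt_const h] with y hy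
    rw [clamp_of_abs_le hy.le]
  · have h0 : f (clamp r x) = 0 := by
      rcases le_abs'.1 h with h | h
      · rw [clamp_of_le_neg hr h, h2]
      · rw [clamp_of_le hr h, h1]
    have hd := hF (clamp r x)
    rw [h0] at hd ⊢
    rw [hasDerivAt_iff_isLittleO] at hd ⊢
    have hc : Filter.Tendsto (clamp r) (nhds x) (nhds (clamp r x)) :=
      (lipschitzWith_clamp r).continuous.tendsto x
    have hO : (fun y => clamp r y - clamp r x) =O[nhds x] fun y => y - x :=
      Asymptotics.IsBigO.of_bound 1 (Filter.Eventually.of_forall fun y => by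
        simpa [dist_eq_norm] using (lipschitzWith_clamp r).dist_le_mul y x)
    simpa only [Function.comp_def, smul_zero] using (hd.comp_tendsto hc).trans_isBigO hO

/-! ### The explicit minimiser -/

section Minimiser

variable {ρ w c r μ : ℝ}

/-- The function `a - x² / 2 + α cos (μ x)` with `a = r² / 2 + 1 / μ²` and `α = w / μ²`. -/
noncomputable def profile (w r μ x : ℝ) : ℝ := r ^ 2 / 2 + 1 / μ ^ 2 - x ^ 2 / 2 + w / μ ^ 2 * Real.cos (μ * x)

/-- The first derivative of `profile`. -/
noncomputable def profileDeriv (w μ x : ℝ) : ℝ := -x - w / μ * Real.sin (μ * x)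

/-- The second derivative of `profile`. -/
noncomputable def profileDeriv2 (w μ x : ℝ) : ℝ := -1 - w * Real.cos (μ * x)

/-- The minimiser: `profile` on `[-r, r]`, continued by its value `0` at `±r`. -/
noncomputable def minimiser (w r μ x : ℝ) : ℝ := profile w r μ (clamp r x)

lemma hasDerivAt_profile (hμ : μ ≠ 0) (x : ℝ) :
    HasDerivAt (profile w r μ) (profileDeriv w μ x) x := by
  have hm := (hasDerivAt_id' x).const_mul μ
  have h := (((((hasDerivAt_id' x).pow 2).div_const 2).const_sub (r ^ 2 / 2 + 1 / μ ^ 2))).add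
    (((Real.hasDerivAt_cos (μ * x)).comp x hm).const_mul (w / μ ^ 2))
  refine h.congr_deriv ?_
  rw [profileDeriv]
  push_cast
  field_simp
  ring

lemma hasDerivAt_profileDeriv (hμ : μ ≠ 0) (x : ℝ) :
    HasDerivAt (profileDeriv w μ) (profileDeriv2 w μ x) x := by
  have hm := (hasDerivAt_id' x).const_mul μ
  have h := ((hasDerivAt_id' x).neg).sub
    (((Real.hasDerivAt_sin (μ * x)).comp x hm).const_mul (w / μ))
  refine h.congr_deriv ?_
  rw [profileDeriv2]
  field_simp

lemma hasDerivAt_profileDeriv2 (x : ℝ) :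
    HasDerivAt (profileDeriv2 w μ) (w * μ * Real.sin (μ * x)) x := by
  have hm := (hasDerivAt_id' x).const_mul μ
  have h := (((Real.hasDerivAt_cos (μ * x)).comp x hm).const_mul w).const_sub (-1)
  refine h.congr_deriv ?_
  ring

lemma profile_neg (x : ℝ) : profile w r μ (-x) = profile w r μ x := by
  simp [profile]

lemma profileDeriv_neg (x : ℝ) : profileDeriv w μ (-x) = -profileDeriv w μ x := by
  simp [profileDeriv]; ring

lemma profileDeriv2_neg (x : ℝ) : profileDeriv2 w μ (-x) = profileDeriv2 w μ x := by
  simp [profileDeriv2]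

/-- The relations between the constants of the minimiser. -/
structure MinimiserConstants (ρ w c r μ : ℝ) : Prop extends ProfileConstants ρ w c where
  r_pos : 0 < r
  r_cube : r ^ 3 = 6
  mul_eq : μ * r = ρ

namespace MinimiserConstants

lemma mu_pos (Q : MinimiserConstants ρ w c r μ) : 0 < μ :=
  pos_of_mul_pos_left (by rw [Q.mul_eq]; exact Q.pos) Q.r_pos.le

lemma cos_eq (Q : MinimiserConstants ρ w c r μ) : Real.cos (μ * r) = -1 / w := by
  rw [Q.mul_eq, eq_div_iff Q.w_pos.ne']; linarith [Q.w_mul_cos]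

lemma sin_eq (Q : MinimiserConstants ρ w c r μ) : Real.sin (μ * r) = -ρ / w := by
  rw [Q.mul_eq, eq_div_iff Q.w_pos.ne']; linarith [Q.w_mul_sin]

lemma profile_r (Q : MinimiserConstants ρ w c r μ) : profile w r μ r = 0 := by
  have := Q.mu_pos
  have := Q.w_pos
  rw [profile, Q.cos_eq]
  field_simp
  ring

lemma profileDeriv_r (Q : MinimiserConstants ρ w c r μ) : profileDeriv w μ r = 0 := by
  have := Q.mu_pos
  have := Q.w_pos
  rw [profileDeriv, Q.sin_eq, ← Q.mul_eq]
  field_simp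
  ring

lemma profileDeriv2_r (Q : MinimiserConstants ρ w c r μ) : profileDeriv2 w μ r = 0 := by
  have := Q.w_pos
  rw [profileDeriv2, Q.cos_eq]
  field_simp
  ring

lemma hasDerivAt_minimiser (Q : MinimiserConstants ρ w c r μ) (x : ℝ) :
    HasDerivAt (minimiser w r μ) (profileDeriv w μ (clamp r x)) x :=
  hasDerivAt_comp_clamp Q.r_pos (hasDerivAt_profile Q.mu_pos.ne') Q.profileDeriv_r
    (by rw [profileDeriv_neg, Q.profileDeriv_r, neg_zero]) x

lemma hasDerivAt_deriv_minimiser (Q : MinimiserConstants ρ w c r μ) (x : ℝ) :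
    HasDerivAt (fun y => profileDeriv w μ (clamp r y)) (profileDeriv2 w μ (clamp r x)) x :=
  hasDerivAt_comp_clamp Q.r_pos (hasDerivAt_profileDeriv Q.mu_pos.ne') Q.profileDeriv2_r
    (by rw [profileDeriv2_neg, Q.profileDeriv2_r]) x

lemma deriv_minimiser (Q : MinimiserConstants ρ w c r μ) :
    deriv (minimiser w r μ) = fun x => profileDeriv w μ (clamp r x) :=
  funext fun x => (Q.hasDerivAt_minimiser x).deriv

lemma deriv_deriv_minimiser (Q : MinimiserConstants ρ w c r μ) :
    deriv (deriv (minimiser w r μ)) = fun x => profileDeriv2 w μ (clamp r x) := by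
  rw [Q.deriv_minimiser]
  exact funext fun x => (Q.hasDerivAt_deriv_minimiser x).deriv

lemma lipschitzWith_deriv_deriv_minimiser (Q : MinimiserConstants ρ w c r μ) :
    LipschitzWith (Real.toNNReal (w * μ)) (deriv (deriv (minimiser w r μ))) := by
  have hwμ : 0 < w * μ := mul_pos Q.w_pos Q.mu_pos
  have h : LipschitzWith (Real.toNNReal (w * μ)) (profileDeriv2 w μ) := by
    refine lipschitzWith_of_nnnorm_deriv_le
      (fun x => (hasDerivAt_profileDeriv2 x).differentiableAt) fun x => ?_
    rw [(hasDerivAt_profileDeriv2 x).deriv, ← NNReal.coe_le_coe, coe_nnnorm,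
      Real.coe_toNNReal _ hwμ.le, norm_mul, Real.norm_of_nonneg hwμ.le]
    exact mul_le_of_le_one_right hwμ.le (Real.abs_sin_le_one _)
  rw [Q.deriv_deriv_minimiser]
  simpa [Function.comp_def] using h.comp (lipschitzWith_clamp r)

lemma contDiff_minimiser (Q : MinimiserConstants ρ w c r μ) : ContDiff ℝ 2 (minimiser w r μ) := by
  have h1 : ContDiff ℝ 1 (deriv (minimiser w r μ)) := by
    rw [contDiff_one_iff_deriv]
    refine ⟨fun x => ?_, Q.lipschitzWith_deriv_deriv_minimiser.continuous⟩
    rw [Q.deriv_minimiser]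
    exact (Q.hasDerivAt_deriv_minimiser x).differentiableAt
  have h2 : ContDiff ℝ (1 + 1) (minimiser w r μ) :=
    contDiff_succ_iff_deriv.2 ⟨fun x => (Q.hasDerivAt_minimiser x).differentiableAt,
      by simp, h1⟩
  convert h2 using 1
  norm_num

/-- The third derivative of the minimiser jumps at `r`, from `w μ sin ρ = -μ ρ` to `0`. -/
lemma not_contDiff_three_minimiser (Q : MinimiserConstants ρ w c r μ) :
    ¬ ContDiff ℝ 3 (minimiser w r μ) := by
  intro h
  have h' : ContDiff ℝ (2 + 1) (minimiser w r μ) := by convert h using 1; norm_num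
  have h2 : ContDiff ℝ 2 (deriv (minimiser w r μ)) := (contDiff_succ_iff_deriv.1 h').2.2
  have hd : HasDerivAt (deriv (deriv (minimiser w r μ))) _ r :=
    (((contDiff_one_deriv h2).differentiable (by norm_num)) r).hasDerivAt
  rw [Q.deriv_deriv_minimiser] at hd
  have hR : HasDerivWithinAt (fun x => profileDeriv2 w μ (clamp r x)) 0 (Ici r) r := by
    refine (hasDerivWithinAt_const r (Ici r) (profileDeriv2 w μ r)).congr (fun y hy => ?_) ?_
    · rw [clamp_of_le Q.r_pos hy]
    · rw [clamp_of_le Q.r_pos le_rfl]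
  have hL : HasDerivWithinAt (fun x => profileDeriv2 w μ (clamp r x))
      (w * μ * Real.sin (μ * r)) (Icc 0 r) r := by
    refine (hasDerivAt_profileDeriv2 r).hasDerivWithinAt.congr (fun y hy => ?_) ?_
    · rw [clamp_of_abs_le (abs_le.2 ⟨by linarith [hy.1, Q.r_pos], hy.2⟩)]
    · rw [clamp_of_le Q.r_pos le_rfl]
  have e1 := (uniqueDiffOn_Ici r r self_mem_Ici).eq_deriv _ hd.hasDerivWithinAt hR
  have e2 := (uniqueDiffOn_Icc Q.r_pos r ⟨Q.r_pos.le, le_rfl⟩).eq_deriv _ hd.hasDerivWithinAt hL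
  rw [e1, Q.sin_eq] at e2
  have h1 := Q.w_pos
  have h2 := Q.mu_pos
  have h3 := Q.pos
  field_simp at e2
  nlinarith [mul_pos h2 h3]

lemma minimiser_eq_zero (Q : MinimiserConstants ρ w c r μ) {x : ℝ} (h : r ≤ |x|) :
    minimiser w r μ x = 0 := by
  rcases le_abs'.1 h with h | h
  · rw [minimiser, clamp_of_le_neg Q.r_pos h, profile_neg, Q.profile_r]
  · rw [minimiser, clamp_of_le Q.r_pos h, Q.profile_r]

lemma hasCompactSupport_minimiser (Q : MinimiserConstants ρ w c r μ) :
    HasCompactSupport (minimiser w r μ) :=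
  HasCompactSupport.intro (isCompact_Icc (a := -r) (b := r)) fun _ hx =>
    Q.minimiser_eq_zero (le_of_not_gt fun h => hx (abs_le.1 h.le))

lemma minimiser_neg (Q : MinimiserConstants ρ w c r μ) (x : ℝ) :
    minimiser w r μ (-x) = minimiser w r μ x := by
  rcases le_or_gt r |x| with h | h
  · rw [Q.minimiser_eq_zero h, Q.minimiser_eq_zero (by rwa [abs_neg])]
  · rw [minimiser, minimiser, clamp_of_abs_le h.le, clamp_of_abs_le (by rw [abs_neg]; exact h.le),
      profile_neg]

/-- `y + w sin y > 0` on `(0, ρ)`: on `[π, ρ]` the left side decreases to its value `0` at `ρ`. -/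
lemma add_mul_sin_pos (Q : MinimiserConstants ρ w c r μ) {y : ℝ} (h0 : 0 < y) (h1 : y < ρ) :
    0 < y + w * Real.sin y := by
  rcases le_or_gt y Real.pi with h | h
  · have := Real.sin_nonneg_of_nonneg_of_le_pi h0.le h
    have := mul_nonneg Q.w_pos.le this
    linarith
  · have hanti : StrictAntiOn (fun z => z + w * Real.sin z) (Icc Real.pi ρ) := by
      refine strictAntiOn_of_deriv_neg (convex_Icc _ _) (by fun_prop) fun x hx => ?_
      rw [interior_Icc] at hx
      have hd : HasDerivAt (fun z => z + w * Real.sin z) (1 + w * Real.cos x) x :=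
        (hasDerivAt_id' x).add ((Real.hasDerivAt_sin x).const_mul w)
      rw [hd.deriv]
      have hcos : Real.cos x < Real.cos ρ := by
        rw [← Real.cos_two_pi_sub x, ← Real.cos_two_pi_sub ρ]
        have := Q.le_two_pi
        exact Real.cos_lt_cos_of_nonneg_of_le_pi (by linarith) (by linarith [hx.1])
          (by linarith [hx.2])
      have := mul_lt_mul_of_pos_left hcos Q.w_pos
      linarith [Q.w_mul_cos]
    have := hanti ⟨h.le, h1.le⟩ ⟨(h.trans h1).le, le_rfl⟩ h1
    simp only at this
    linarith [Q.w_mul_sin]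

lemma profileDeriv_neg_of_mem (Q : MinimiserConstants ρ w c r μ) {x : ℝ} (h0 : 0 < x)
    (h1 : x < r) : profileDeriv w μ x < 0 := by
  have hμ := Q.mu_pos
  have h := Q.add_mul_sin_pos (mul_pos hμ h0)
    (by rw [← Q.mul_eq]; exact mul_lt_mul_of_pos_left h1 hμ)
  have : profileDeriv w μ x = -(μ * x + w * Real.sin (μ * x)) / μ := by
    rw [profileDeriv]; field_simp; ring
  rw [this]
  exact div_neg_of_neg_of_pos (by linarith) hμ

lemma strictAntiOn_minimiser (Q : MinimiserConstants ρ w c r μ) :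
    StrictAntiOn (minimiser w r μ) (Icc 0 r) := by
  refine strictAntiOn_of_deriv_neg (convex_Icc _ _) Q.contDiff_minimiser.continuous.continuousOn
    fun x hx => ?_
  rw [interior_Icc] at hx
  rw [Q.deriv_minimiser]
  simp only
  rw [clamp_of_abs_le (by rw [abs_of_pos hx.1]; exact hx.2.le)]
  exact Q.profileDeriv_neg_of_mem hx.1 hx.2

lemma antitoneOn_minimiser (Q : MinimiserConstants ρ w c r μ) :
    AntitoneOn (minimiser w r μ) (Ici 0) := by
  refine antitoneOn_of_deriv_nonpos (convex_Ici _) Q.contDiff_minimiser.continuous.continuousOn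
    (fun x _ => (Q.hasDerivAt_minimiser x).differentiableAt.differentiableWithinAt) fun x hx => ?_
  rw [interior_Ici] at hx
  rw [Q.deriv_minimiser]
  simp only
  rcases lt_or_ge x r with h | h
  · rw [clamp_of_abs_le (by rw [abs_of_pos hx]; exact h.le)]
    exact (Q.profileDeriv_neg_of_mem hx h).le
  · rw [clamp_of_le Q.r_pos h, Q.profileDeriv_r]

lemma strictMonoOn_minimiser (Q : MinimiserConstants ρ w c r μ) :
    StrictMonoOn (minimiser w r μ) (Icc (-r) 0) := fun x hx y hy hxy => by
  rw [← Q.minimiser_neg x, ← Q.minimiser_neg y]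
  exact Q.strictAntiOn_minimiser ⟨by linarith [hy.2], by linarith [hy.1]⟩
    ⟨by linarith [hx.2], by linarith [hx.1]⟩ (neg_lt_neg hxy)

lemma monotoneOn_minimiser (Q : MinimiserConstants ρ w c r μ) :
    MonotoneOn (minimiser w r μ) (Iic 0) := fun x hx y hy hxy => by
  rw [← Q.minimiser_neg x, ← Q.minimiser_neg y]
  exact Q.antitoneOn_minimiser (mem_Ici.2 (neg_nonneg.2 hy)) (mem_Ici.2 (neg_nonneg.2 hx))
    (neg_le_neg hxy)

lemma minimiser_pos (Q : MinimiserConstants ρ w c r μ) {x : ℝ} (h : |x| < r) :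
    0 < minimiser w r μ x := by
  have h1 : minimiser w r μ |x| = minimiser w r μ x := by
    rcases abs_choice x with h | h <;> rw [h]
    exact Q.minimiser_neg x
  have h2 := Q.strictAntiOn_minimiser ⟨abs_nonneg x, h.le⟩ ⟨Q.r_pos.le, le_rfl⟩ h
  rwa [Q.minimiser_eq_zero (le_abs_self r), h1] at h2

lemma setOf_minimiser_pos (Q : MinimiserConstants ρ w c r μ) :
    {x | 0 < minimiser w r μ x} = Ioo (-r) r := by
  ext x
  rw [mem_ofPred_eq, mem_Ioo, ← abs_lt]
  refine ⟨fun h => lt_of_not_ge fun h' => ?_, Q.minimiser_pos⟩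
  rw [Q.minimiser_eq_zero h'] at h
  exact lt_irrefl _ h

lemma minimiser_nonneg (Q : MinimiserConstants ρ w c r μ) (x : ℝ) : 0 ≤ minimiser w r μ x := by
  rcases lt_or_ge |x| r with h | h
  · exact (Q.minimiser_pos h).le
  · exact (Q.minimiser_eq_zero h).ge

/-! ### Energy and excess length of the minimiser -/

/-- Integrals of functions continued by zero at `±r`. -/
lemma integral_comp_clamp {F G : ℝ → ℝ} (hr : 0 < r) (hF : ∀ x, HasDerivAt G (F x) x)
    (hc : Continuous F) (h1 : F r = 0) (h2 : F (-r) = 0) :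
    ∫ x, F (clamp r x) = G r - G (-r) := by
  have hsupp : Function.support (fun x => F (clamp r x)) ⊆ Ioc (-r) r := by
    intro x hx
    by_contra hn
    refine hx ?_
    simp only [mem_Ioc, not_and_or, not_lt, not_le] at hn
    rcases hn with h | h
    · simp only [clamp_of_le_neg hr h, h2]
    · simp only [clamp_of_le hr h.le, h1]
  rw [← intervalIntegral.integral_eq_integral_of_support_subset hsupp]
  have : ∫ x in (-r)..r, F (clamp r x) = ∫ x in (-r)..r, F x := by
    refine intervalIntegral.integral_congr fun x hx => ?_
    rw [uIcc_of_le (by linarith)] at hx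
    simp only [clamp_of_abs_le (abs_le.2 hx)]
  rw [this]
  exact intervalIntegral.integral_eq_sub_of_hasDerivAt (fun x _ => hF x)
    (hc.intervalIntegrable _ _)

lemma integral_profileDeriv2_sq (Q : MinimiserConstants ρ w c r μ) :
    ∫ x, profileDeriv2 w μ (clamp r x) ^ 2 = r * ρ ^ 2 := by
  have hμ := Q.mu_pos
  have hw := Q.w_pos
  have h := integral_comp_clamp (F := fun x => profileDeriv2 w μ x ^ 2)
    (G := fun x => x + 2 * w / μ * Real.sin (μ * x)
      + w ^ 2 / 2 * (x + Real.sin (μ * x) * Real.cos (μ * x) / μ)) Q.r_pos (fun x => ?_)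
    (by unfold profileDeriv2; fun_prop) (by simp [Q.profileDeriv2_r])
    (by simp [profileDeriv2_neg, Q.profileDeriv2_r])
  · rw [h]
    simp only [mul_neg, Real.sin_neg, Real.cos_neg]
    rw [Q.sin_eq, Q.cos_eq, ← Q.mul_eq]
    have := Q.w_sq
    rw [← Q.mul_eq] at this
    field_simp
    linear_combination 2 * r * this
  · have hm := (hasDerivAt_id' x).const_mul μ
    have hs := (Real.hasDerivAt_sin (μ * x)).comp x hm
    have hc := (Real.hasDerivAt_cos (μ * x)).comp x hm
    have hd := ((hasDerivAt_id' x).add (hs.const_mul (2 * w / μ))).add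
      ((((hasDerivAt_id' x).add ((hs.mul hc).div_const μ))).const_mul (w ^ 2 / 2))
    refine hd.congr_deriv ?_
    simp only [Function.comp, profileDeriv2]
    have := Real.sin_sq_add_cos_sq (μ * x)
    generalize Real.sin (μ * x) = S at *
    generalize Real.cos (μ * x) = C at *
    field_simp
    linear_combination (-w ^ 2) * this

lemma integral_profileDeriv_sq (Q : MinimiserConstants ρ w c r μ) :
    ∫ x, profileDeriv w μ (clamp r x) ^ 2 = 10 := by
  have hμ := Q.mu_pos
  have hw := Q.w_pos
  have h := integral_comp_clamp (F := fun x => profileDeriv w μ x ^ 2)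
    (G := fun x => x ^ 3 / 3 + 2 * w / μ * (Real.sin (μ * x) / μ ^ 2 - x * Real.cos (μ * x) / μ)
      + w ^ 2 / (2 * μ ^ 2) * (x - Real.sin (μ * x) * Real.cos (μ * x) / μ)) Q.r_pos (fun x => ?_)
    (by unfold profileDeriv; fun_prop) (by simp [Q.profileDeriv_r])
    (by simp [profileDeriv_neg, Q.profileDeriv_r])
  · rw [h]
    simp only [mul_neg, Real.sin_neg, Real.cos_neg]
    rw [Q.sin_eq, Q.cos_eq, ← Q.mul_eq]
    have := Q.w_sq
    rw [← Q.mul_eq] at this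
    have h6 := Q.r_cube
    field_simp
    grind
  · have hm := (hasDerivAt_id' x).const_mul μ
    have hs := (Real.hasDerivAt_sin (μ * x)).comp x hm
    have hc := (Real.hasDerivAt_cos (μ * x)).comp x hm
    have hd := ((((hasDerivAt_id' x).pow 3).div_const 3).add
      (((hs.div_const (μ ^ 2)).sub (((hasDerivAt_id' x).mul hc).div_const μ)).const_mul
      (2 * w / μ))).add
      ((((hasDerivAt_id' x).sub ((hs.mul hc).div_const μ))).const_mul (w ^ 2 / (2 * μ ^ 2)))
    refine hd.congr_deriv ?_
    simp only [Function.comp, profileDeriv]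
    have := Real.sin_sq_add_cos_sq (μ * x)
    generalize Real.sin (μ * x) = S at *
    generalize Real.cos (μ * x) = C at *
    push_cast
    field_simp
    grind

lemma integral_minimiser (Q : MinimiserConstants ρ w c r μ) : ∫ x, minimiser w r μ x = 4 := by
  have hμ := Q.mu_pos
  have hw := Q.w_pos
  have h := integral_comp_clamp (F := profile w r μ)
    (G := fun x => (r ^ 2 / 2 + 1 / μ ^ 2) * x - x ^ 3 / 6 + w / μ ^ 3 * Real.sin (μ * x))
    Q.r_pos (fun x => ?_) (by unfold profile; fun_prop) Q.profile_r
    (by rw [profile_neg, Q.profile_r])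
  · unfold minimiser
    rw [h]
    simp only [mul_neg, Real.sin_neg]
    rw [Q.sin_eq, ← Q.mul_eq]
    have h6 := Q.r_cube
    field_simp
    grind
  · have hm := (hasDerivAt_id' x).const_mul μ
    have hs := (Real.hasDerivAt_sin (μ * x)).comp x hm
    have hd := ((((hasDerivAt_id' x).const_mul (r ^ 2 / 2 + 1 / μ ^ 2))).sub
      (((hasDerivAt_id' x).pow 3).div_const 6)).add (hs.const_mul (w / μ ^ 3))
    refine hd.congr_deriv ?_
    rw [profile]
    push_cast
    field_simp
    ring

lemma bendingEnergy_minimiser (Q : MinimiserConstants ρ w c r μ) :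
    bendingEnergy (minimiser w r μ) = r * ρ ^ 2 := by
  rw [bendingEnergy_of_contDiff_two Q.contDiff_minimiser, Q.deriv_deriv_minimiser]
  exact Q.integral_profileDeriv2_sq

lemma minimiser_mem_sobolevClass (Q : MinimiserConstants ρ w c r μ) :
    minimiser w r μ ∈ sobolevClass := by
  have hs := Q.contDiff_minimiser
  have hcs := Q.hasCompactSupport_minimiser
  refine ⟨memW22_of_contDiff_two hs hcs, hs.continuous.integrable_of_hasCompactSupport hcs,
    Filter.Eventually.of_forall Q.minimiser_nonneg, ?_⟩
  rw [excessLength_of_contDiff_two hs hcs, Q.deriv_minimiser, Q.integral_profileDeriv_sq,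
    Q.integral_minimiser]
  norm_num

end MinimiserConstants

end Minimiser

/-! ### The constants and the theorem -/

lemma exists_minimiserConstants :
    ∃ ρ w c r μ : ℝ, IsLeast {x : ℝ | 0 < x ∧ Real.tan x = x} ρ ∧ r = (6 : ℝ) ^ (1 / 3 : ℝ) ∧
      MinimiserConstants ρ w c r μ := by
  obtain ⟨ρ, hρ, h1, h2, h3⟩ := exists_least_tan_eq_self
  have hρ0 : 0 < ρ := hρ.1.1
  have hπ1 := Real.pi_gt_three
  have hπ2 := Real.pi_lt_d2
  have hcos : Real.cos ρ < 0 := by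
    norm_num at h1 h2 hπ2
    exact Real.cos_neg_of_pi_div_two_lt_of_lt (by linarith) (by linarith)
  set w := -1 / Real.cos ρ with hw
  have hw0 : 0 < w := div_pos_of_neg_of_neg (by norm_num) hcos
  have hwc : w * Real.cos ρ = -1 := by rw [hw, div_mul_cancel₀ _ hcos.ne]
  have hr : 0 < (6 : ℝ) ^ (1 / 3 : ℝ) := by positivity
  refine ⟨ρ, w, 1 / (ρ ^ 2 / 2 + w + 1), (6 : ℝ) ^ (1 / 3 : ℝ), ρ / (6 : ℝ) ^ (1 / 3 : ℝ), hρ, rfl,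
    { lower := h1, upper := h2, w_pos := hw0, w_sq := ?_, w_mul_cos := hwc, w_mul_sin := ?_,
      c_mul := ?_, r_pos := hr, r_cube := rpow_one_third_pow_three (by norm_num), mul_eq := ?_ }⟩
  · have := Real.sin_sq_add_cos_sq ρ
    rw [h3] at this
    have h4 : w ^ 2 * ((ρ * Real.cos ρ) ^ 2 + Real.cos ρ ^ 2)
        = (w * Real.cos ρ) ^ 2 * (1 + ρ ^ 2) := by ring
    rw [this, hwc] at h4
    linarith
  · rw [h3]; linear_combination ρ * hwc
  · field_simp
  · field_simp

namespace MinimiserConstants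

variable {ρ w c r μ : ℝ}

lemma r_bounds (Q : MinimiserConstants ρ w c r μ) : 1.8171 < r ∧ r < 1.8172 :=
  ⟨lt_of_pow_lt_pow_left₀ 3 Q.r_pos.le (by rw [Q.r_cube]; norm_num),
    lt_of_pow_lt_pow_left₀ 3 (by norm_num) (by rw [Q.r_cube]; norm_num)⟩

lemma mu_bounds (Q : MinimiserConstants ρ w c r μ) : 2.4726 < μ ∧ μ < 2.473 := by
  have hr := Q.r_bounds
  have h1 := Q.lower
  have h2 := Q.upper
  have h3 := Q.mul_eq
  have h4 := Q.mu_pos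
  norm_num at hr h1 h2 ⊢
  constructor <;> nlinarith

end MinimiserConstants

theorem theorem2 :
    ∃ (ρ r μ α a : ℝ) (u : ℝ → ℝ),
      -- the parameters
      IsLeast {x : ℝ | 0 < x ∧ Real.tan x = x} ρ ∧
      r = (6 : ℝ) ^ (1 / 3 : ℝ) ∧
      μ * r = ρ ∧
      α = -(r / (μ * Real.sin (μ * r))) ∧
      a = r ^ 2 / 2 + r / μ * (Real.cos (μ * r) / Real.sin (μ * r)) ∧
      |r - 1.82| < 0.005 ∧ |μ - 2.47| < 0.005 ∧ |α - 0.75| < 0.005 ∧ |a - 1.81| < 0.005 ∧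
      -- the explicit form of the minimiser
      (∀ x, u x = if |x| < r then a - x ^ 2 / 2 + α * Real.cos (μ * x) else 0) ∧
      -- it minimises the energy in the larger class
      u ∈ sobolevClass ∧
      (∀ φ ∈ sobolevClass, bendingEnergy u ≤ bendingEnergy φ) ∧
      -- the minimal energy, which is also the infimum over smooth functions
      IsGLB (bendingEnergy '' smoothClass) (bendingEnergy u) ∧
      bendingEnergy u = (6 : ℝ) ^ (1 / 3 : ℝ) * ρ ^ 2 ∧
      |bendingEnergy u - 36.69| < 0.005 ∧
      Integrable (fun x => (weakDeriv (weakDeriv u) x) ^ 2) ∧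
      1 < bendingEnergy u ∧
      -- regularity: of class `C^{2,1}`, but not of class `C^3`
      ContDiff ℝ 2 u ∧
      (∃ K, LipschitzWith K (iteratedDeriv 2 u)) ∧
      ¬ ContDiff ℝ 3 u ∧
      -- shape
      HasCompactSupport u ∧
      IsConnected {x | 0 < u x} ∧
      (∀ x, u (-x) = u x) ∧
      MonotoneOn u (Iic 0) ∧ AntitoneOn u (Ici 0) ∧
      StrictMonoOn u (Icc (-r) 0) ∧ StrictAntiOn u (Icc 0 r) := by
  obtain ⟨ρ, w, c, r, μ, hρ, hr, Q⟩ := exists_minimiserConstants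
  have hμ0 := Q.mu_pos
  have hr0 := Q.r_pos
  have hw0 := Q.w_pos
  have hρ0 := Q.pos
  obtain ⟨r1, r2⟩ := Q.r_bounds
  obtain ⟨m1, m2⟩ := Q.mu_bounds
  have ρ1 := Q.lower
  have ρ2 := Q.upper
  have w1 := Q.w_lower
  have w2 := Q.w_upper
  norm_num at r1 r2 m1 m2 ρ1 ρ2 w1 w2
  have hs := Q.contDiff_minimiser
  have hcs := Q.hasCompactSupport_minimiser
  have hE := Q.bendingEnergy_minimiser
  have hmem := Q.minimiser_mem_sobolevClass
  have hmin : ∀ φ ∈ sobolevClass, bendingEnergy (minimiser w r μ) ≤ bendingEnergy φ :=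
    fun φ hφ => by
      rw [hE, hr]
      exact le_bendingEnergy Q.toProfileConstants hφ
  have hα : w / μ ^ 2 = -(r / (μ * Real.sin (μ * r))) := by
    rw [Q.sin_eq, ← Q.mul_eq]
    field_simp
  have ha : r ^ 2 / 2 + 1 / μ ^ 2
      = r ^ 2 / 2 + r / μ * (Real.cos (μ * r) / Real.sin (μ * r)) := by
    rw [Q.sin_eq, Q.cos_eq, ← Q.mul_eq]
    field_simp
  have hsq1 : (44933 / 10000 : ℝ) ^ 2 < ρ ^ 2 := by gcongr
  have hsq2 : ρ ^ 2 < (8987 / 2000 : ℝ) ^ 2 := by gcongr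
  have hE1 : (18171 / 10000 : ℝ) * (44933 / 10000) ^ 2 < r * ρ ^ 2 := by gcongr
  have hE2 : r * ρ ^ 2 < (4543 / 2500 : ℝ) * (8987 / 2000) ^ 2 := by gcongr
  have hμ1 : (12363 / 5000 : ℝ) ^ 2 < μ ^ 2 := by gcongr
  have hμ2 : μ ^ 2 < (2473 / 1000 : ℝ) ^ 2 := by gcongr
  have hr1 : (18171 / 10000 : ℝ) ^ 2 < r ^ 2 := by gcongr
  have hr2 : r ^ 2 < (4543 / 2500 : ℝ) ^ 2 := by gcongr
  norm_num at hE1 hE2 hμ1 hμ2 hr1 hr2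
  refine ⟨ρ, r, μ, w / μ ^ 2, r ^ 2 / 2 + 1 / μ ^ 2, minimiser w r μ, hρ, hr, Q.mul_eq, hα, ha,
    ?_, ?_, ?_, ?_, ?_, hmem, hmin, ⟨?_, ?_⟩, by rw [hE, hr], ?_, ?_, ?_, hs, ⟨Real.toNNReal (w * μ), ?_⟩,
    Q.not_contDiff_three_minimiser, hcs, ?_, Q.minimiser_neg, Q.monotoneOn_minimiser,
    Q.antitoneOn_minimiser, Q.strictMonoOn_minimiser, Q.strictAntiOn_minimiser⟩
  · rw [abs_lt]; norm_num; constructor <;> linarith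
  · rw [abs_lt]; norm_num; constructor <;> linarith
  · have h1 : (747 / 1000 : ℝ) < w / μ ^ 2 := by rw [lt_div_iff₀ (by positivity)]; linarith
    have h2 : w / μ ^ 2 < (7545 / 10000 : ℝ) := by rw [div_lt_iff₀ (by positivity)]; linarith
    rw [abs_lt]; norm_num; constructor <;> linarith
  · have h1 : (163 / 1000 : ℝ) < 1 / μ ^ 2 := by rw [lt_div_iff₀ (by positivity)]; linarith
    have h2 : 1 / μ ^ 2 < (1636 / 10000 : ℝ) := by rw [div_lt_iff₀ (by positivity)]; linarith
    rw [abs_lt]; norm_num at h1 h2 ⊢; constructor <;> linarith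
  · intro x
    split_ifs with h
    · rw [minimiser, clamp_of_abs_le h.le, profile]
    · exact Q.minimiser_eq_zero (not_lt.1 h)
  · rintro _ ⟨φ, hφ, rfl⟩
    exact hmin φ (smoothClass_subset_sobolevClass hφ)
  · intro b hb
    refine le_of_forall_pos_le_add fun ε hε => ?_
    obtain ⟨φ, hφ, hlt⟩ := exists_mem_smoothClass_bendingEnergy_lt hmem hε
    exact (hb ⟨φ, hφ, rfl⟩).trans hlt.le
  · rw [hE, abs_lt]; norm_num; constructor <;> linarith
  · have h := hasWeakDeriv_of_contDiff_two hs
    refine (integrable_deriv_deriv_sq hs hcs).congr ?_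
    exact (h.1.weakDeriv_weakDeriv_ae_eq h.2).symm.mono fun x hx => by simp only [hx]
  · rw [hE]; linarith
  · rw [iteratedDeriv_succ, iteratedDeriv_one]
    exact Q.lipschitzWith_deriv_deriv_minimiser
  · rw [Q.setOf_minimiser_pos]
    exact isConnected_Ioo (by linarith)
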